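/- **Setting.** Let $d\in\{1,2,3\}$, let $R\subset\mathbb R^d$ be a nonempty bounded convex domain with outer unit normal $\mathbf n$ on $\partial R$, and let $S\subset\mathbb R^3$ be the unit sphere; $s\cdot\mathbf n$ and $s_n$ refer to the first $d$ coordinates of $s\in S$. Let $\sigma_a,\sigma_s\in L^\infty(R)$ with $\sigma_s\ge 0$ and $\sigma_a\ge\gamma>0$ a.e., $\sigma_t=\sigma_a+\sigma_s$, $c=\|\sigma_s/\sigma_t\|_{L^\infty(R)}$, and let $0\le g<1$. Put $(\mathcal S u)(s)=\int_S k(s\cdot s')u(s')\,ds'$ with the Henyey–Greenstein kernel $k(t)=\frac1{4\pi}\frac{1-g^2}{(1-2gt+g^2)^{3/2}}$. **Discretization.** Let $\mathcal T_h^R$ be a conforming simplicial triangulation of $R$, and let $\mathcal T_h^S=\{\pm K_1,\dots,\pm K_{n_S^+}\}$ be a triangulation of $S$ into spherical triangles. Let $\{\varphi_i\}$ be a basis of the continuous functions on $\overline R$ that are affine on each element of $\mathcal T_h^R$, $\{\chi_j\}$ a basis of the piecewise constant functions on $\mathcal T_h^R$, $\mu_k^+$ the indicator function of $K_k\cup -K_k$,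 and $\{\psi_l^-\}$ a basis of the (finite-dimensional) space of odd functions on $S$ whose restriction to each $K_k$ lies in a given space of functions continuous on $K_k$ (for instance the linear functions $s\mapsto b\cdot s$). With $w\in\{s,t\}$ define $$(\mathfrak M^+_w)_{ii'}=\int_R\sigma_w\varphi_i\varphi_{i'},\quad(\mathfrak M^-_w)_{jj'}=\int_R\sigma_w\chi_j\chi_{j'},\quad(\mathfrak D_n)_{ji}=\int_R\frac{\partial\varphi_i}{\partial r_n}\chi_j,\quad(\mathfrak R_k)_{ii'}=\int_{\partial R}\varphi_i\varphi_{i'}\omega_k,\quad\omega_k=\int_S|s\cdot\mathbf n|(\mu_k^+)^2ds,$$ $$(\mathsf M^+)_{kk'}=\int_S\mu_k^+\mu_{k'}^+,\quad(\mathsf M^-)_{ll'}=\int_S\psi_l^-\psi_{l'}^-,\quad(\mathsf S^+)_{kk'}=\int_S(\mathcal S\mu_k^+)\mu_{k'}^+,\quad(\mathsf S^-)_{ll'}=\int_S(\mathcal S\psi_l^-)\psi_{l'}^-,\quad(\mathsf A_n)_{lk}=\int_S s_n\psi_l^-\mu_k^+,$$ and $\mathbf K^\pm=\mathsf S^\pm\otimes\mathfrak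 M_s^\pm$, $\mathbf M^\pm=\mathsf M^\pm\otimes\mathfrak M_t^\pm$, $\mathbf A=\sum_{n=1}^d\mathsf A_n\otimes\mathfrak D_n$, $\mathbf R=\operatorname{blkdiag}(\mathfrak R_1,\dots,\mathfrak R_{n_S^+})$, $$\mathbf E=\mathbf A^\top(\mathbf M^--\mathbf K^-)^{-1}\mathbf A+\mathbf M^++\mathbf R,\qquad \mathbf E_0=\tfrac1{1-cg}\mathbf A^\top(\mathbf M^-)^{-1}\mathbf A+\mathbf R+\mathbf M^+ .$$ **Iterations.** For $l\ge1$ let $\mathbf P_1^l$ be the matrix with $\mathbf P_1^l\mathbf b=\mathbf z_l$, where $\mathbf z_0=0$ and $\mathbf z_{k+1}=\mathbf z_k-\mathbf E_0^{-1}(\mathbf E\mathbf z_k-\mathbf b)$. Let $\mathbf W$ be any matrix with linearly independent columns of length $n_S^+n_R^+$, where $n_R^+$ is the number of the $\varphi_i$, and let $\mathbf P_G=\mathbf W(\mathbf W^\top(\mathbf E-\mathbf K^+)\mathbf W)^{-1}\mathbf W^\top(\mathbf E-\mathbf K^+)$. Given vectors $\mathbf q$ and $\mathbf u_0$, consider with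 $\mathbf P_1=\mathbf P_1^l$ the outer iteration $$\mathbf u_{n+1}=\mathbf u_n-\mathbf P_2\mathbf P_1\big((\mathbf E-\mathbf K^+)\mathbf u_n-\mathbf q\big),\qquad \mathbf P_2\mathbf P_1=\mathbf P_1+\mathbf W(\mathbf W^\top(\mathbf E-\mathbf K^+)\mathbf W)^{-1}\mathbf W^\top(\mathbf I-(\mathbf E-\mathbf K^+)\mathbf P_1).$$ For a symmetric positive definite matrix $\mathbf Q$ put $\|\mathbf x\|_{\mathbf Q}=(\mathbf x^\top\mathbf Q\mathbf x)^{1/2}$. **Lemma.** The matrices $\mathbf M^-$, $\mathbf M^--\mathbf K^-$, $\mathbf E$, $\mathbf E_0$, $\mathbf E-\mathbf K^+$ and $\mathbf W^\top(\mathbf E-\mathbf K^+)\mathbf W$ are symmetric positive definite, so that everything above is well defined. For every $l\ge 1$, $\mathbf P_1^l$ is symmetric positive definite and $$\mathbf x^\top\mathbf E_0^{-1}\mathbf x\le\mathbf x^\top\mathbf P_1^l\mathbf x\le\mathbf x^\top\mathbf E^{-1}\mathbf x\qquad\text{for all }\mathbf x .$$ The number $$\eta=\sup\big\{\|(\mathbf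 I-\mathbf P_G)(\mathbf I-\mathbf P_1^l(\mathbf E-\mathbf K^+))\mathbf v\|_{\mathbf E-\mathbf K^+}:\ \|\mathbf v\|_{\mathbf E-\mathbf K^+}=1\big\}$$ satisfies $0\le\eta\le c<1$. For every $\mathbf q$ the equation $\mathbf E\mathbf u=\mathbf K^+\mathbf u+\mathbf q$ has a unique solution $\mathbf u$, and for every $\mathbf u_0$ the outer iteration satisfies $$\|\mathbf u-\mathbf u_{n+1}\|_{\mathbf E-\mathbf K^+}\le\eta\,\|\mathbf u-\mathbf u_n\|_{\mathbf E-\mathbf K^+}\quad(n\ge0),\qquad \mathbf u_n\to\mathbf u .$$ -/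

import Mathlib

open MeasureTheory Matrix Filter Topology
open scoped Kronecker Pointwise

noncomputable section

namespace RTE

/-- The position space `ℝ^d`. -/
abbrev Pos (d : ℕ) : Type := EuclideanSpace ℝ (Fin d)

/-- The space `ℝ³` that contains the unit directions. -/
abbrev E3 : Type := EuclideanSpace ℝ (Fin 3)

/-- The unit sphere `S ⊂ ℝ³` of directions of propagation. -/
abbrev Sph : Type := Metric.sphere (0 : E3) 1

/-- The surface measure `ds` on `S` (total mass `4π`). -/
def dS : Measure Sph := (volume : Measure E3).toSphere

/-! ### The physical data -/

/-- A bounded convex domain `R ⊂ ℝ^d` (`d = 1, 2, 3`) with outer unit normal field `n`, absorption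
rate `σa`, scattering rate `σs`, and anisotropy factor `g`. The normal is only determined (and only
used) almost everywhere on `∂R` with respect to the surface measure. -/
structure Medium (d : ℕ) where
  dim_pos : 1 ≤ d
  dim_le : d ≤ 3
  R : Set (Pos d)
  isOpen_R : IsOpen R
  nonempty_R : R.Nonempty
  bounded_R : Bornology.IsBounded R
  convex_R : Convex ℝ R
  n : Pos d → Pos d
  measurable_n : Measurable n
  n_normal : ∀ᵐ r ∂((μHE[d - 1] : Measure (Pos d)).restrict (frontier R)),
    ‖n r‖ = 1 ∧ ∀ y ∈ R, inner ℝ (y - r) (n r) ≤ 0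
  σa : Pos d → ℝ
  σs : Pos d → ℝ
  memLp_σa : MemLp σa ⊤ (volume.restrict R)
  memLp_σs : MemLp σs ⊤ (volume.restrict R)
  σs_nonneg : ∀ᵐ r ∂(volume.restrict R), 0 ≤ σs r
  absorbing : ∃ γ : ℝ, 0 < γ ∧ ∀ᵐ r ∂(volume.restrict R), γ ≤ σa r
  g : ℝ
  g_nonneg : 0 ≤ g
  g_lt_one : g < 1

namespace Medium

variable {d : ℕ} (M : Medium d)

/-- Total attenuation `σt = σa + σs`. -/
def σt (r : Pos d) : ℝ := M.σa r + M.σs r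

/-- `c = ‖σs / σt‖_∞`, the essential supremum over `R`. -/
def c : ℝ := (eLpNorm (fun r => M.σs r / M.σt r) ⊤ (volume.restrict M.R)).toReal

/-- The component of the direction `s ∈ S ⊂ ℝ³` that acts on the position variable in `ℝ^d`:
its first `d` coordinates (`s` itself if `d = 3`). -/
def dir (s : Sph) : Pos d := WithLp.toLp 2 fun i => (s : E3) (Fin.castLE M.dim_le i)

/-- The Henyey-Greenstein phase function `k(t)`, where `t = s · s'`. -/
def phase (t : ℝ) : ℝ :=
  1 / (4 * Real.pi) * ((1 - M.g ^ 2) / (1 - 2 * M.g * t + M.g ^ 2) ^ (3 / 2 : ℝ))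

/-- The scattering operator `(𝒮 u)(s) = ∫_S k(s·s') u(s') ds'`. -/
def scatter (u : Sph → ℝ) (s : Sph) : ℝ :=
  ∫ s' : Sph, M.phase (inner ℝ (s : E3) (s' : E3)) * u s' ∂dS

end Medium

/-! ### Discretization of the sphere -/

/-- The (closed) spherical triangle with vertices `v 0, v 1, v 2`: the points of the sphere in the
convex cone spanned by the vertices, i.e. the radial projection of the flat triangle. -/
def sphTriangle (v : Fin 3 → E3) : Set Sph :=
  {s | ∃ t : Fin 3 → ℝ, (∀ i, 0 ≤ t i) ∧ (s : E3) = ∑ i, t i • v i}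

/-- The relative interior of the spherical triangle with vertices `v 0, v 1, v 2`. -/
def sphTriangleInt (v : Fin 3 → E3) : Set Sph :=
  {s | ∃ t : Fin 3 → ℝ, (∀ i, 0 < t i) ∧ (s : E3) = ∑ i, t i • v i}

/-- A triangulation of `S` into nondegenerate spherical triangles `K_1, …, K_m, -K_1, …, -K_m`, so
that `-K` is an element whenever `K` is one. The `K_k` are the elements with midpoint in a chosen
half-sphere. -/
structure SphereMesh (m : ℕ) where
  vertex : Fin m → Fin 3 → E3
  norm_vertex : ∀ k i, ‖vertex k i‖ = 1
  nondegenerate : ∀ k, LinearIndependent ℝ (vertex k)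
  disjoint_same : ∀ k k', k ≠ k' →
    Disjoint (sphTriangleInt (vertex k)) (sphTriangleInt (vertex k'))
  disjoint_opposite : ∀ k k',
    Disjoint (sphTriangleInt (vertex k)) (-sphTriangleInt (vertex k'))
  cover : ∀ s : Sph, ∃ k, s ∈ sphTriangle (vertex k) ∨ s ∈ -sphTriangle (vertex k)

namespace SphereMesh

variable {m : ℕ} (T : SphereMesh m)

/-- The basis function `μ_k⁺` of the space `𝕊_h⁺` of even piecewise constant functions: the
indicator function of `K_k ∪ -K_k` (elements taken without their boundary, a null set). -/
def mu (k : Fin m) : Sph → ℝ :=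
  (sphTriangleInt (T.vertex k) ∪ -sphTriangleInt (T.vertex k)).indicator fun _ => 1

/-- The space `𝕊_h⁻` of odd functions on `S` whose restriction to the interior of each element
`K_k` belongs to the local space `P k` (with value zero on the element boundaries, a null set).
By oddness this determines the restrictions to the elements `-K_k`. -/
def oddSpace (P : Fin m → Submodule ℝ (Sph → ℝ)) : Submodule ℝ (Sph → ℝ) where
  carrier := {f | (∀ s, f (-s) = -f s) ∧
    (∀ k, ∃ p ∈ P k, Set.EqOn f p (sphTriangleInt (T.vertex k))) ∧
    ∀ s, (∀ k, s ∉ sphTriangleInt (T.vertex k) ∧ -s ∉ sphTriangleInt (T.vertex k)) → f s = 0}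
  add_mem' := by
    rintro f f' ⟨h1, h2, h3⟩ ⟨h1', h2', h3'⟩
    refine ⟨fun s => ?_, fun k => ?_, fun s hs => ?_⟩
    · simp only [Pi.add_apply, h1 s, h1' s]; ring
    · obtain ⟨p, hp, hfp⟩ := h2 k
      obtain ⟨p', hp', hfp'⟩ := h2' k
      exact ⟨p + p', (P k).add_mem hp hp', fun s hs => by simp [hfp hs, hfp' hs]⟩
    · simp [h3 s hs, h3' s hs]
  zero_mem' := ⟨by simp, fun k => ⟨0, (P k).zero_mem, fun _ _ => rfl⟩, by simp⟩
  smul_mem' := by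
    rintro a f ⟨h1, h2, h3⟩
    refine ⟨fun s => ?_, fun k => ?_, fun s hs => ?_⟩
    · simp [h1 s]
    · obtain ⟨p, hp, hfp⟩ := h2 k
      exact ⟨a • p, (P k).smul_mem a hp, fun s hs => by simp [hfp hs]⟩
    · simp [h3 s hs]

end SphereMesh

/-- The restrictions to `S` of the linear forms `s ↦ b · s` on `ℝ³`: the standard three-dimensional
local space of piecewise linear functions on spherical elements. -/
def linearForms : Submodule ℝ (Sph → ℝ) where
  carrier := {f | ∃ b : E3, ∀ s : Sph, f s = inner ℝ b (s : E3)}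
  add_mem' := by
    rintro f f' ⟨b, hb⟩ ⟨b', hb'⟩
    exact ⟨b + b', fun s => by simp [hb s, hb' s, inner_add_left]⟩
  zero_mem' := ⟨0, by simp⟩
  smul_mem' := by
    rintro a f ⟨b, hb⟩
    exact ⟨a • b, fun s => by simp [hb s, inner_smul_left]⟩

theorem continuous_of_mem_linearForms {f : Sph → ℝ} (hf : f ∈ linearForms) : Continuous f := by
  obtain ⟨b, hb⟩ := hf
  have h : f = fun s : Sph => inner ℝ b (s : E3) := funext hb
  rw [h]
  fun_prop

/-! ### Discretization of the domain -/

/-- A (conforming, simplicial) triangulation of `R`. -/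
structure DomainMesh {d : ℕ} (R : Set (Pos d)) where
  complex : Geometry.SimplicialComplex ℝ (Pos d)
  finite_faces : complex.faces.Finite
  space_eq : complex.space = closure R

namespace DomainMesh

variable {d : ℕ} {R : Set (Pos d)} (T : DomainMesh R)

/-- The elements of the triangulation: the (vertex sets of the) `d`-simplices. -/
def elements : Set (Finset (Pos d)) := {t | t ∈ T.complex.faces ∧ t.card = d + 1}

/-- `ℙ₁ᶜ(𝒯_h^R)`: the continuous functions on the closure of `R` that are affine on each element
(extended by zero outside of the closure of `R`). -/
def P1c : Submodule ℝ (Pos d → ℝ) where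
  carrier := {f | ContinuousOn f (closure R) ∧
    (∀ t ∈ T.elements, ∃ a : Pos d →ᵃ[ℝ] ℝ, Set.EqOn f a (convexHull ℝ (t : Set (Pos d)))) ∧
    ∀ r, r ∉ closure R → f r = 0}
  add_mem' := by
    rintro f f' ⟨h1, h2, h3⟩ ⟨h1', h2', h3'⟩
    refine ⟨h1.add h1', fun t ht => ?_, fun r hr => by simp [h3 r hr, h3' r hr]⟩
    obtain ⟨a, ha⟩ := h2 t ht
    obtain ⟨a', ha'⟩ := h2' t ht
    exact ⟨a + a', fun r hr => by simp [ha hr, ha' hr]⟩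
  zero_mem' := ⟨continuousOn_const, fun t _ => ⟨0, fun _ _ => rfl⟩, by simp⟩
  smul_mem' := by
    rintro b f ⟨h1, h2, h3⟩
    refine ⟨h1.const_smul b, fun t ht => ?_, fun r hr => by simp [h3 r hr]⟩
    obtain ⟨a, ha⟩ := h2 t ht
    exact ⟨b • a, fun r hr => by simp [ha hr]⟩

/-- `ℙ₀(𝒯_h^R)`: the functions that are constant on (the interior of) each element and zero
elsewhere. -/
def P0 : Submodule ℝ (Pos d → ℝ) where
  carrier := {f |
    (∀ t ∈ T.elements, ∃ a : ℝ, ∀ r ∈ interior (convexHull ℝ (t : Set (Pos d))), f r = a) ∧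
    ∀ r, (∀ t ∈ T.elements, r ∉ interior (convexHull ℝ (t : Set (Pos d)))) → f r = 0}
  add_mem' := by
    rintro f f' ⟨h2, h3⟩ ⟨h2', h3'⟩
    refine ⟨fun t ht => ?_, fun r hr => by simp [h3 r hr, h3' r hr]⟩
    obtain ⟨a, ha⟩ := h2 t ht
    obtain ⟨a', ha'⟩ := h2' t ht
    exact ⟨a + a', fun r hr => by simp [ha r hr, ha' r hr]⟩
  zero_mem' := ⟨fun t _ => ⟨0, fun _ _ => rfl⟩, by simp⟩
  smul_mem' := by
    rintro b f ⟨h2, h3⟩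
    refine ⟨fun t ht => ?_, fun r hr => by simp [h3 r hr]⟩
    obtain ⟨a, ha⟩ := h2 t ht
    exact ⟨b * a, fun r hr => by simp [ha r hr]⟩

end DomainMesh

/-! ### The Galerkin matrices -/

/-- The triangulations of `R` and `S` and the bases `{φ_i}`, `{χ_j}`, `{ψ_l⁻}` of the spaces
`𝕏_h⁺`, `𝕏_h⁻`, `𝕊_h⁻` (the basis `{μ_k⁺}` of `𝕊_h⁺` is given by `SphereMesh.mu`). The local space
`localP k` of shape functions on the spherical element `K_k` is an arbitrary space of functions
that are continuous on the element; piecewise linear functions are obtained with `linearForms`. -/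
structure Discretization {d : ℕ} (M : Medium d) where
  nRp : ℕ
  nRm : ℕ
  nSp : ℕ
  nSm : ℕ
  domainMesh : DomainMesh M.R
  sphereMesh : SphereMesh nSp
  localP : Fin nSp → Submodule ℝ (Sph → ℝ)
  localP_continuousOn : ∀ k, ∀ p ∈ localP k, ContinuousOn p (sphTriangle (sphereMesh.vertex k))
  φ : Module.Basis (Fin nRp) ℝ domainMesh.P1c
  χ : Module.Basis (Fin nRm) ℝ domainMesh.P0
  ψ : Module.Basis (Fin nSm) ℝ (sphereMesh.oddSpace localP)

namespace Discretization

variable {d : ℕ} {M : Medium d} (D : Discretization M)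

/-- Index set of the even unknowns, in angle-major order. -/
abbrev IdxP : Type := Fin D.nSp × Fin D.nRp

/-- Index set of the odd unknowns, in angle-major order. -/
abbrev IdxM : Type := Fin D.nSm × Fin D.nRm

/-- `φ_i` as a function. -/
def phi (i : Fin D.nRp) : Pos d → ℝ := (D.φ i : Pos d → ℝ)

/-- `χ_j` as a function. -/
def chi (j : Fin D.nRm) : Pos d → ℝ := (D.χ j : Pos d → ℝ)

/-- `ψ_l⁻` as a function. -/
def psi (l : Fin D.nSm) : Sph → ℝ := (D.ψ l : Sph → ℝ)

/-- `μ_k⁺` as a function. -/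
def mu (k : Fin D.nSp) : Sph → ℝ := D.sphereMesh.mu k

/-- `𝔐⁺_w` for a weight `w` (`w = σt` or `w = σs`). -/
def massRp (w : Pos d → ℝ) : Matrix (Fin D.nRp) (Fin D.nRp) ℝ :=
  Matrix.of fun i i' => ∫ r in M.R, w r * D.phi i r * D.phi i' r

/-- `𝔐⁻_w` for a weight `w` (`w = σt` or `w = σs`). -/
def massRm (w : Pos d → ℝ) : Matrix (Fin D.nRm) (Fin D.nRm) ℝ :=
  Matrix.of fun j j' => ∫ r in M.R, w r * D.chi j r * D.chi j' r

/-- `𝖬⁺`, the Gramian of `{μ_k⁺}` in `L²(S)`. -/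
def gramSp : Matrix (Fin D.nSp) (Fin D.nSp) ℝ :=
  Matrix.of fun k k' => ∫ s, D.mu k s * D.mu k' s ∂dS

/-- `𝖬⁻`, the Gramian of `{ψ_l⁻}` in `L²(S)`. -/
def gramSm : Matrix (Fin D.nSm) (Fin D.nSm) ℝ :=
  Matrix.of fun l l' => ∫ s, D.psi l s * D.psi l' s ∂dS

/-- `𝖲⁺`. -/
def scatSp : Matrix (Fin D.nSp) (Fin D.nSp) ℝ :=
  Matrix.of fun k k' => ∫ s, M.scatter (D.mu k) s * D.mu k' s ∂dS

/-- `𝖲⁻`. -/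
def scatSm : Matrix (Fin D.nSm) (Fin D.nSm) ℝ :=
  Matrix.of fun l l' => ∫ s, M.scatter (D.psi l) s * D.psi l' s ∂dS

/-- `𝖠_n`. -/
def angA (n : Fin d) : Matrix (Fin D.nSm) (Fin D.nSp) ℝ :=
  Matrix.of fun l k => ∫ s, M.dir s n * D.psi l s * D.mu k s ∂dS

/-- `𝔇_n`. -/
def derD (n : Fin d) : Matrix (Fin D.nRm) (Fin D.nRp) ℝ :=
  Matrix.of fun j i =>
    ∫ r in M.R, lineDeriv ℝ (D.phi i) r (EuclideanSpace.single n 1) * D.chi j r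

/-- `ω_k(r) = ∫_S |s · n(r)| (μ_k⁺)² ds`. -/
def omega (k : Fin D.nSp) (r : Pos d) : ℝ :=
  ∫ s, |inner ℝ (M.dir s) (M.n r)| * D.mu k s ^ 2 ∂dS

/-- `ℜ_k`, with the integral taken with respect to the surface measure of `∂R`. -/
def bdryR (k : Fin D.nSp) : Matrix (Fin D.nRp) (Fin D.nRp) ℝ :=
  Matrix.of fun i i' =>
    ∫ r in frontier M.R, D.phi i r * D.phi i' r * D.omega k r ∂(μHE[d - 1] : Measure (Pos d))

/-- `K⁺ = 𝖲⁺ ⊗ 𝔐⁺_s`. -/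
def Kp : Matrix D.IdxP D.IdxP ℝ := D.scatSp ⊗ₖ D.massRp M.σs

/-- `K⁻ = 𝖲⁻ ⊗ 𝔐⁻_s`. -/
def Km : Matrix D.IdxM D.IdxM ℝ := D.scatSm ⊗ₖ D.massRm M.σs

/-- `M⁺ = 𝖬⁺ ⊗ 𝔐⁺_t`. -/
def Mp : Matrix D.IdxP D.IdxP ℝ := D.gramSp ⊗ₖ D.massRp M.σt

/-- `M⁻ = 𝖬⁻ ⊗ 𝔐⁻_t`. -/
def Mm : Matrix D.IdxM D.IdxM ℝ := D.gramSm ⊗ₖ D.massRm M.σt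

/-- `A = ∑_n 𝖠_n ⊗ 𝔇_n`. -/
def A : Matrix D.IdxM D.IdxP ℝ := ∑ n : Fin d, D.angA n ⊗ₖ D.derD n

/-- `R = blkdiag(ℜ_1, …, ℜ_{n_S⁺})`. -/
def Rmat : Matrix D.IdxP D.IdxP ℝ :=
  Matrix.of fun a b => if a.1 = b.1 then D.bdryR a.1 a.2 b.2 else 0

/-- The even-parity matrix `E = Aᵀ (M⁻ - K⁻)⁻¹ A + M⁺ + R`. -/
def E : Matrix D.IdxP D.IdxP ℝ := D.Aᵀ * (D.Mm - D.Km)⁻¹ * D.A + D.Mp + D.Rmat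

/-- `E₀ = (1 - c g)⁻¹ Aᵀ (M⁻)⁻¹ A + R + M⁺`. -/
def E0 : Matrix D.IdxP D.IdxP ℝ :=
  (1 / (1 - M.c * M.g)) • (D.Aᵀ * D.Mm⁻¹ * D.A) + D.Rmat + D.Mp

end Discretization

/-! ### The iterations -/

variable {ι κ : Type*} [Fintype ι] [DecidableEq ι] [Fintype κ] [DecidableEq κ]

/-- The inner Richardson iteration `z_0 = 0`, `z_{k+1} = z_k - E₀⁻¹ (E z_k - b)`. -/
def innerIterate (E E₀ : Matrix ι ι ℝ) (b : ι → ℝ) : ℕ → ι → ℝ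
  | 0 => 0
  | k + 1 => innerIterate E E₀ b k - E₀⁻¹ *ᵥ (E *ᵥ innerIterate E E₀ b k - b)

/-- The matrix `P₁ˡ` of the linear map `b ↦ z_l`: its `j`-th column is `z_l` for `b = e_j`. -/
def innerPrecond (E E₀ : Matrix ι ι ℝ) (l : ℕ) : Matrix ι ι ℝ :=
  Matrix.of fun i j => innerIterate E E₀ (Pi.single j 1) l i

theorem innerPrecond_zero (E E₀ : Matrix ι ι ℝ) : innerPrecond E E₀ 0 = 0 := by
  ext i j; simp [innerPrecond, innerIterate]

theorem innerPrecond_succ (E E₀ : Matrix ι ι ℝ) (l : ℕ) :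
    innerPrecond E E₀ (l + 1) =
      innerPrecond E E₀ l - E₀⁻¹ * (E * innerPrecond E E₀ l - 1) := by
  ext i j
  have hcol : ∀ (B C : Matrix ι ι ℝ), (B * C) i j = (B *ᵥ fun a => C a j) i := fun B C => rfl
  have h : (fun a => (E * innerPrecond E E₀ l - 1) a j) =
      E *ᵥ innerIterate E E₀ (Pi.single j 1) l - Pi.single j 1 := by
    ext a
    simp only [Matrix.sub_apply, Pi.sub_apply, Matrix.one_apply, Pi.single_apply]
    rfl
  rw [Matrix.sub_apply, hcol, h]
  rfl

theorem innerPrecond_mulVec (E E₀ : Matrix ι ι ℝ) (l : ℕ) (b : ι → ℝ) :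
    innerPrecond E E₀ l *ᵥ b = innerIterate E E₀ b l := by
  induction l with
  | zero => simp [innerPrecond_zero, innerIterate]
  | succ l ih =>
    rw [innerPrecond_succ, innerIterate, ← ih]
    simp only [Matrix.sub_mulVec, ← Matrix.mulVec_mulVec, Matrix.one_mulVec]

/-- The energy norm `‖x‖_Q = (xᵀ Q x)^{1/2}`. -/
def energyNorm (Q : Matrix ι ι ℝ) (x : ι → ℝ) : ℝ := √(x ⬝ᵥ Q *ᵥ x)

/-- The Galerkin projection `P_G = W (Wᵀ Q W)⁻¹ Wᵀ Q` onto the span of the columns of `W`. -/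
def galerkinProj (Q : Matrix ι ι ℝ) (W : Matrix ι κ ℝ) : Matrix ι ι ℝ :=
  W * (Wᵀ * Q * W)⁻¹ * Wᵀ * Q

/-- The overall preconditioner `P₂ P₁ = P₁ + W (Wᵀ Q W)⁻¹ Wᵀ (I - Q P₁)`. -/
def overallPrecond (Q P₁ : Matrix ι ι ℝ) (W : Matrix ι κ ℝ) : Matrix ι ι ℝ :=
  P₁ + W * (Wᵀ * Q * W)⁻¹ * Wᵀ * (1 - Q * P₁)

/-- The outer iteration `u_{n+1} = u_n - P₂ P₁ (Q u_n - q)`. -/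
def outerIterate (Q P₁ : Matrix ι ι ℝ) (W : Matrix ι κ ℝ) (q u₀ : ι → ℝ) : ℕ → ι → ℝ
  | 0 => u₀
  | n + 1 => outerIterate Q P₁ W q u₀ n -
      overallPrecond Q P₁ W *ᵥ (Q *ᵥ outerIterate Q P₁ W q u₀ n - q)

/-- The values `‖(I - P_G)(I - P₁ Q) v‖_Q` with `‖v‖_Q = 1`, whose supremum is the contraction
factor `η`. -/
def contractionValues (Q P₁ : Matrix ι ι ℝ) (W : Matrix ι κ ℝ) : Set ℝ :=
  {y | ∃ v : ι → ℝ, energyNorm Q v = 1 ∧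
    y = energyNorm Q (((1 - galerkinProj Q W) * (1 - P₁ * Q)) *ᵥ v)}

end RTE

end

/-! ### Positive definite real matrices -/

namespace Matrix

set_option linter.unusedSectionVars false

variable {ι κ : Type*} [Fintype ι] [Fintype κ]

/-! Write `Q = E - K⁺` and order symmetric matrices by their quadratic forms. The whole statement
rests on the chain `(1 - c) Q⁻¹ ≤ E₀⁻¹ ≤ P₁ˡ ≤ E⁻¹ ≤ Q⁻¹`. It gives `0 ≤ Q⁻¹ - P₁ˡ ≤ c Q⁻¹`, so by
Cauchy-Schwarz `I - P₁ˡ Q` contracts the `Q`-norm by the factor `c` (`energyNorm_one_sub_mul_le`).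
The factor `I - P_G` is the complement of a `Q`-orthogonal projection and does not increase the
norm.

The two inner inequalities are pure linear algebra. Given `E ≤ E₀`, the Richardson error is `E⁻¹ -
P₁ˡ = Gˡ E⁻¹` with `G = I - E₀⁻¹ E`, and the increments are `Gˡ E₀⁻¹`; both are positive
semidefinite for either parity of `l` (`pow_mul_posSemidef`).

The outer inequalities and `E ≤ E₀` come from `0 ≤ K⁻ ≤ c g M⁻` and `0 ≤ K⁺ ≤ c M⁺`, because
inversion reverses the order (`PosDef.inv_sub_inv_posSemidef`). The Kronecker structure separates
these bounds into `σs ≤ c σt` in space and three bounds for the form `∫ f 𝒮f` on the sphere.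

The angular bounds are obtained without spherical harmonics. The form is nonnegative because the
Henyey-Greenstein kernel is a power series in `s · s'` with nonnegative coefficients. It is at most
`‖f‖²` because the kernel is symmetric, nonnegative and has integral one. It is at most `g ‖f‖²` on
odd functions by a ground-state argument: on functions antisymmetric under a mirror reflection, the
antisymmetrized kernel is compared with the eigenfunction `s ↦ e · s` of eigenvalue `g`
(`scatForm_self_le_of_antisymm`), and every odd function splits into three components, each
antisymmetric under one of the coordinate reflections. -/

theorem posSemidef_real_iff {A : Matrix ι ι ℝ} :
    A.PosSemidef ↔ A.IsSymm ∧ ∀ x, 0 ≤ x ⬝ᵥ A *ᵥ x := by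
  rw [posSemidef_iff_dotProduct_mulVec]
  simp [IsHermitian, IsSymm, conjTranspose_eq_transpose_of_trivial]

theorem posDef_real_iff {A : Matrix ι ι ℝ} :
    A.PosDef ↔ A.IsSymm ∧ ∀ x, x ≠ 0 → 0 < x ⬝ᵥ A *ᵥ x := by
  rw [posDef_iff_dotProduct_mulVec]
  simp [IsHermitian, IsSymm, conjTranspose_eq_transpose_of_trivial]

theorem PosSemidef.isSymm {A : Matrix ι ι ℝ} (h : A.PosSemidef) : Aᵀ = A :=
  (posSemidef_real_iff.1 h).1

theorem PosSemidef.form_nonneg {A : Matrix ι ι ℝ} (h : A.PosSemidef) (x : ι → ℝ) :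
    0 ≤ x ⬝ᵥ A *ᵥ x :=
  (posSemidef_real_iff.1 h).2 x

theorem PosDef.form_pos {A : Matrix ι ι ℝ} (h : A.PosDef) {x : ι → ℝ} (hx : x ≠ 0) :
    0 < x ⬝ᵥ A *ᵥ x :=
  (posDef_real_iff.1 h).2 x hx

theorem form_le_of_sub_posSemidef {A B : Matrix ι ι ℝ} (h : (B - A).PosSemidef) (x : ι → ℝ) :
    x ⬝ᵥ A *ᵥ x ≤ x ⬝ᵥ B *ᵥ x := by
  have := h.form_nonneg x
  rw [sub_mulVec, dotProduct_sub] at this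
  linarith

theorem dotProduct_mulVec_symm {A : Matrix ι ι ℝ} (h : Aᵀ = A) (x y : ι → ℝ) :
    x ⬝ᵥ A *ᵥ y = y ⬝ᵥ A *ᵥ x := by
  rw [dotProduct_mulVec, ← mulVec_transpose, h, dotProduct_comm]

/-- The Cauchy-Schwarz inequality for a positive semidefinite form. -/
theorem PosSemidef.cauchy_schwarz {A : Matrix ι ι ℝ} (h : A.PosSemidef) (x y : ι → ℝ) :
    (x ⬝ᵥ A *ᵥ y) ^ 2 ≤ (x ⬝ᵥ A *ᵥ x) * (y ⬝ᵥ A *ᵥ y) := by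
  have key : ∀ t : ℝ, 0 ≤ (x ⬝ᵥ A *ᵥ x) * (t * t) + (2 * (x ⬝ᵥ A *ᵥ y)) * t + y ⬝ᵥ A *ᵥ y := by
    intro t
    have := h.form_nonneg (t • x + y)
    simp only [mulVec_add, mulVec_smul, dotProduct_add, add_dotProduct, smul_dotProduct,
      dotProduct_smul, smul_eq_mul, dotProduct_mulVec_symm h.isSymm y x] at this
    linarith
  have := discrim_le_zero key
  rw [discrim] at this
  linarith

theorem PosSemidef.transpose_mul_mul_same {A : Matrix ι ι ℝ} (h : A.PosSemidef)
    (B : Matrix ι κ ℝ) : (Bᵀ * A * B).PosSemidef := by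
  simpa [conjTranspose_eq_transpose_of_trivial] using h.conjTranspose_mul_mul_same B

theorem PosSemidef.mul_mul_transpose_same {A : Matrix ι ι ℝ} (h : A.PosSemidef)
    (B : Matrix κ ι ℝ) : (B * A * Bᵀ).PosSemidef := by
  simpa [conjTranspose_eq_transpose_of_trivial] using h.mul_mul_conjTranspose_same B

theorem PosDef.transpose_mul_mul_of_linearIndependent {A : Matrix ι ι ℝ} (h : A.PosDef)
    {W : Matrix ι κ ℝ} (hW : LinearIndependent ℝ W.col) : (Wᵀ * A * W).PosDef := by
  rw [posDef_real_iff]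
  refine ⟨(h.posSemidef.transpose_mul_mul_same W).isSymm, fun x hx => ?_⟩
  have hWx : W *ᵥ x ≠ 0 := fun h0 => hx <| by
    apply Matrix.mulVec_injective_iff.2 hW
    simpa using h0
  have := h.form_pos hWx
  rwa [← mulVec_mulVec, ← mulVec_mulVec, dotProduct_mulVec, vecMul_transpose]

theorem PosDef.of_sub_posSemidef {A B : Matrix ι ι ℝ} (hA : A.PosDef) (h : (B - A).PosSemidef) :
    B.PosDef := by
  simpa using hA.add_posSemidef h

variable [DecidableEq ι]

theorem PosDef.isUnit_det {A : Matrix ι ι ℝ} (h : A.PosDef) : IsUnit A.det :=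
  (isUnit_iff_isUnit_det A).1 h.isUnit

/-- With `z = A⁻¹x` and `y = B⁻¹x`, expand `0 ≤ (z - y)ᵀ A (z - y) = xᵀA⁻¹x - 2 xᵀB⁻¹x + yᵀAy` and
use `yᵀAy ≤ yᵀBy = xᵀB⁻¹x`. No square roots of matrices are needed. -/
theorem PosDef.inv_sub_inv_posSemidef {A B : Matrix ι ι ℝ} (hA : A.PosDef)
    (h : (B - A).PosSemidef) : (A⁻¹ - B⁻¹).PosSemidef := by
  have hB : B.PosDef := hA.of_sub_posSemidef h
  rw [posSemidef_real_iff]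
  refine ⟨?_, fun x => ?_⟩
  · rw [IsSymm, transpose_sub, hA.inv.posSemidef.isSymm, hB.inv.posSemidef.isSymm]
  · have hAi : A * A⁻¹ = 1 := mul_nonsing_inv _ hA.isUnit_det
    have hBi : B * B⁻¹ = 1 := mul_nonsing_inv _ hB.isUnit_det
    have h1 := hA.posSemidef.form_nonneg (A⁻¹ *ᵥ x - B⁻¹ *ᵥ x)
    have h2 := form_le_of_sub_posSemidef h (B⁻¹ *ᵥ x)
    have e1 : A *ᵥ (A⁻¹ *ᵥ x) = x := by rw [mulVec_mulVec, hAi, one_mulVec]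
    have e2 : B *ᵥ (B⁻¹ *ᵥ x) = x := by rw [mulVec_mulVec, hBi, one_mulVec]
    have e3 := dotProduct_mulVec_symm hA.posSemidef.isSymm (A⁻¹ *ᵥ x) (B⁻¹ *ᵥ x)
    rw [e2] at h2
    rw [mulVec_sub, e1] at h1
    rw [e1] at e3
    simp only [dotProduct_sub, sub_dotProduct, e3] at h1
    rw [sub_mulVec, dotProduct_sub, dotProduct_comm x, dotProduct_comm x]
    linarith

end Matrix

/-! ### The preconditioned iterations -/

namespace RTE

section LinearAlgebra

set_option linter.unusedSectionVars false

variable {ι κ : Type*} [Fintype ι] [DecidableEq ι] [Fintype κ] [DecidableEq κ]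

/-! ### Inner Richardson iteration -/

theorem innerPrecond_one (E E₀ : Matrix ι ι ℝ) : innerPrecond E E₀ 1 = E₀⁻¹ := by
  rw [innerPrecond_succ, innerPrecond_zero]
  simp

variable {E E₀ : Matrix ι ι ℝ}

theorem pow_mul_eq_mul_transpose_pow {G B : Matrix ι ι ℝ} (hB : G * B = B * Gᵀ) (j : ℕ) :
    G ^ j * B = B * (G ^ j)ᵀ := by
  induction j with
  | zero => simp
  | succ j ih =>
    rw [pow_succ', Matrix.mul_assoc, ih, ← Matrix.mul_assoc, hB, Matrix.mul_assoc,
      ← transpose_mul, ← pow_succ', ← pow_succ]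

/-- Powers of a matrix `G` preserve semidefiniteness of matrices for which `G` is
self-adjoint. -/
theorem pow_mul_posSemidef {G B : Matrix ι ι ℝ} (hB : G * B = B * Gᵀ) (h0 : B.PosSemidef)
    (h1 : (G * B).PosSemidef) (l : ℕ) : (G ^ l * B).PosSemidef := by
  -- Moving half of the powers to the right of `B` turns `G ^ l * B` into a congruence of `B` (even
  -- `l`) or of `G * B` (odd `l`).
  obtain ⟨j, rfl | rfl⟩ := Nat.even_or_odd' l
  · have : G ^ (2 * j) * B = G ^ j * B * (G ^ j)ᵀ := by
      rw [two_mul, pow_add, Matrix.mul_assoc, pow_mul_eq_mul_transpose_pow hB, ← Matrix.mul_assoc,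
        pow_mul_eq_mul_transpose_pow hB]
    rw [this]
    exact h0.mul_mul_transpose_same _
  · have : G ^ (2 * j + 1) * B = G ^ j * (G * B) * (G ^ j)ᵀ := by
      have e : 2 * j + 1 = j + 1 + j := by ring
      rw [e, pow_add, Matrix.mul_assoc, pow_mul_eq_mul_transpose_pow hB, pow_succ]
      simp only [Matrix.mul_assoc]
    rw [this]
    exact h1.mul_mul_transpose_same _

/-- The start `z_0 = 0` makes the initial error `E⁻¹`, and each Richardson step multiplies the error
from the left by `1 - E₀⁻¹ * E`. -/
theorem inv_sub_innerPrecond (hE : E.PosDef) (l : ℕ) :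
    E⁻¹ - innerPrecond E E₀ l = (1 - E₀⁻¹ * E) ^ l * E⁻¹ := by
  have hi : E * E⁻¹ = 1 := mul_nonsing_inv _ hE.isUnit_det
  induction l with
  | zero => simp [innerPrecond_zero]
  | succ l ih =>
    rw [pow_succ', Matrix.mul_assoc, ← ih, innerPrecond_succ, Matrix.sub_mul, Matrix.one_mul,
      Matrix.mul_assoc, Matrix.mul_sub E, hi, Matrix.mul_sub, Matrix.mul_sub]
    abel

variable (hE : E.PosDef) (h : (E₀ - E).PosSemidef)
include hE h

/-- For `G = 1 - E₀⁻¹E` one has `G E⁻¹ = E⁻¹ - E₀⁻¹`, which is semidefinite because `E ≤ E₀`; then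
`pow_mul_posSemidef` applies with `B = E⁻¹`. -/
theorem inv_sub_innerPrecond_posSemidef (l : ℕ) : (E⁻¹ - innerPrecond E E₀ l).PosSemidef := by
  have hE₀ : E₀.PosDef := hE.of_sub_posSemidef h
  have hi : E * E⁻¹ = 1 := mul_nonsing_inv _ hE.isUnit_det
  have hi' : E⁻¹ * E = 1 := nonsing_inv_mul _ hE.isUnit_det
  rw [inv_sub_innerPrecond hE]
  refine pow_mul_posSemidef ?_ hE.inv.posSemidef ?_ l
  · rw [transpose_sub, transpose_mul, hE.posSemidef.isSymm, hE₀.inv.posSemidef.isSymm,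
      Matrix.sub_mul, Matrix.mul_sub, Matrix.mul_assoc, hi, ← Matrix.mul_assoc, hi']
    simp
  · rw [Matrix.sub_mul, Matrix.mul_assoc, hi, Matrix.one_mul, Matrix.mul_one]
    exact hE.inv_sub_inv_posSemidef h

/-- The increment equals `Gˡ E₀⁻¹`, and `G E₀⁻¹ = E₀⁻¹ (E₀ - E) E₀⁻¹` is a congruence of a
semidefinite matrix. The preconditioners therefore increase with `l`, and the lower bound can be
read off at `l = 1`. -/
theorem innerPrecond_succ_sub_posSemidef (l : ℕ) :
    (innerPrecond E E₀ (l + 1) - innerPrecond E E₀ l).PosSemidef := by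
  have hE₀ : E₀.PosDef := hE.of_sub_posSemidef h
  have hi : E * E⁻¹ = 1 := mul_nonsing_inv _ hE.isUnit_det
  have h0i' : E₀⁻¹ * E₀ = 1 := nonsing_inv_mul _ hE₀.isUnit_det
  have key : innerPrecond E E₀ (l + 1) - innerPrecond E E₀ l = (1 - E₀⁻¹ * E) ^ l * E₀⁻¹ := by
    have e : innerPrecond E E₀ (l + 1) - innerPrecond E E₀ l =
        (E⁻¹ - innerPrecond E E₀ l) - (E⁻¹ - innerPrecond E E₀ (l + 1)) := by abel
    rw [e, inv_sub_innerPrecond hE, inv_sub_innerPrecond hE, pow_succ, Matrix.mul_assoc,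
      ← Matrix.mul_sub, Matrix.sub_mul, Matrix.mul_assoc, hi]
    simp
  rw [key]
  refine pow_mul_posSemidef ?_ hE₀.inv.posSemidef ?_ l
  · rw [transpose_sub, transpose_mul, hE.posSemidef.isSymm, hE₀.inv.posSemidef.isSymm,
      Matrix.sub_mul, Matrix.mul_sub, Matrix.mul_assoc]
    simp
  · have e : (1 - E₀⁻¹ * E) * E₀⁻¹ = E₀⁻¹ * (E₀ - E) * (E₀⁻¹)ᵀ := by
      rw [hE₀.inv.posSemidef.isSymm, Matrix.mul_sub, h0i']
    rw [e]
    exact h.mul_mul_transpose_same _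

theorem innerPrecond_sub_inv_posSemidef {l : ℕ} (hl : 1 ≤ l) :
    (innerPrecond E E₀ l - E₀⁻¹).PosSemidef := by
  induction l, hl using Nat.le_induction with
  | base => simpa [innerPrecond_one] using Matrix.PosSemidef.zero
  | succ l _ ih => simpa using ih.add (innerPrecond_succ_sub_posSemidef hE h l)

theorem innerPrecond_posDef {l : ℕ} (hl : 1 ≤ l) : (innerPrecond E E₀ l).PosDef :=
  (hE.of_sub_posSemidef h).inv.of_sub_posSemidef (innerPrecond_sub_inv_posSemidef hE h hl)

omit hE h

/-! ### Energy norm, Galerkin correction and outer iteration -/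

section EnergyNorm

variable {Q : Matrix ι ι ℝ} (hQ : Q.PosDef)
include hQ

theorem energyNorm_sq (x : ι → ℝ) : energyNorm Q x ^ 2 = x ⬝ᵥ Q *ᵥ x :=
  Real.sq_sqrt (hQ.posSemidef.form_nonneg x)

omit hQ in
theorem energyNorm_nonneg (x : ι → ℝ) : 0 ≤ energyNorm Q x := Real.sqrt_nonneg _

omit hQ in
theorem energyNorm_smul {t : ℝ} (ht : 0 ≤ t) (x : ι → ℝ) :
    energyNorm Q (t • x) = t * energyNorm Q x := by
  rw [energyNorm, mulVec_smul, dotProduct_smul, smul_dotProduct, smul_eq_mul, smul_eq_mul,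
    ← mul_assoc, Real.sqrt_mul (mul_self_nonneg t), Real.sqrt_mul_self ht, energyNorm]

theorem energyNorm_pos {x : ι → ℝ} (hx : x ≠ 0) : 0 < energyNorm Q x :=
  Real.sqrt_pos.2 (hQ.form_pos hx)

/-- Convergence in the energy norm implies convergence. -/
theorem tendsto_of_energyNorm_sub {u : ι → ℝ} {v : ℕ → ι → ℝ}
    (h : Tendsto (fun n => energyNorm Q (u - v n)) atTop (𝓝 0)) : Tendsto v atTop (𝓝 u) := by
  have hi : Q * Q⁻¹ = 1 := mul_nonsing_inv _ hQ.isUnit_det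
  rw [tendsto_pi_nhds]
  intro i
  -- The Riesz representer of the `i`-th coordinate in the `Q`-inner product, so that Cauchy-Schwarz
  -- bounds each coordinate by the energy norm.
  set e : ι → ℝ := Q⁻¹ *ᵥ Pi.single i 1
  have hQe : Q *ᵥ e = Pi.single i 1 := by rw [mulVec_mulVec, hi, one_mulVec]
  have hb : ∀ n, |v n i - u i| ≤ energyNorm Q e * energyNorm Q (u - v n) := by
    intro n
    have hcs := hQ.posSemidef.cauchy_schwarz (u - v n) e
    rw [hQe, dotProduct_single, mul_one, ← energyNorm_sq hQ, Pi.sub_apply] at hcs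
    have he : e ⬝ᵥ Pi.single i 1 = energyNorm Q e ^ 2 := by rw [energyNorm_sq hQ, hQe]
    rw [he, ← mul_pow] at hcs
    rw [abs_sub_comm, mul_comm]
    exact abs_le_of_sq_le_sq hcs (mul_nonneg (energyNorm_nonneg _) (energyNorm_nonneg _))
  rw [tendsto_iff_norm_sub_tendsto_zero]
  refine squeeze_zero (fun n => norm_nonneg _) hb ?_
  simpa using h.const_mul (energyNorm Q e)

/-- A symmetric approximation `P` with `(1 - c) Q⁻¹ ≤ P ≤ Q⁻¹` gives the contraction `1 - P Q`. -/
theorem energyNorm_one_sub_mul_le {P : Matrix ι ι ℝ} {c : ℝ} (hc : 0 ≤ c)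
    (h1 : (Q⁻¹ - P).PosSemidef) (h2 : (P - (1 - c) • Q⁻¹).PosSemidef) (v : ι → ℝ) :
    energyNorm Q ((1 - P * Q) *ᵥ v) ≤ c * energyNorm Q v := by
  have hi' : Q⁻¹ * Q = 1 := nonsing_inv_mul _ hQ.isUnit_det
  have hi : Q * Q⁻¹ = 1 := mul_nonsing_inv _ hQ.isUnit_det
  set X := Q⁻¹ - P with hX
  have hXle : ∀ x, x ⬝ᵥ X *ᵥ x ≤ c * (x ⬝ᵥ Q⁻¹ *ᵥ x) := by
    intro x
    have h := form_le_of_sub_posSemidef h2 x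
    simp only [hX, sub_mulVec, dotProduct_sub, smul_mulVec, dotProduct_smul,
      smul_eq_mul] at h ⊢
    linarith
  have hQx : ∀ x, (Q *ᵥ x) ⬝ᵥ Q⁻¹ *ᵥ (Q *ᵥ x) = energyNorm Q x ^ 2 := by
    intro x
    rw [energyNorm_sq hQ, mulVec_mulVec x, hi', one_mulVec, dotProduct_comm]
  have hz : (1 - P * Q) *ᵥ v = X *ᵥ (Q *ᵥ v) := by
    rw [mulVec_mulVec, hX, Matrix.sub_mul, hi']
  rw [hz]
  set z := X *ᵥ (Q *ᵥ v)
  -- The left side is `‖z‖⁴` by the choice of `z`, and the right side is at most `c²‖z‖²‖v‖²` since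
  -- `X ≤ c Q⁻¹`; it remains to cancel a factor `‖z‖`.
  have hcs := h1.cauchy_schwarz (Q *ᵥ z) (Q *ᵥ v)
  have e1 : (Q *ᵥ z) ⬝ᵥ X *ᵥ (Q *ᵥ v) = energyNorm Q z ^ 2 := by
    rw [energyNorm_sq hQ, dotProduct_comm]
  have b1 := hXle (Q *ᵥ z)
  have b2 := hXle (Q *ᵥ v)
  rw [hQx] at b1 b2
  rw [e1] at hcs
  have hN := energyNorm_nonneg (Q := Q) z
  have hV := energyNorm_nonneg (Q := Q) v
  have hle : (energyNorm Q z * energyNorm Q z) ^ 2 ≤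
      (energyNorm Q z * (c * energyNorm Q v)) ^ 2 := by
    calc _ = (energyNorm Q z ^ 2) ^ 2 := by ring
      _ ≤ _ := hcs
      _ ≤ (c * energyNorm Q z ^ 2) * (c * energyNorm Q v ^ 2) :=
        mul_le_mul b1 b2 (h1.form_nonneg _) (by positivity)
      _ = _ := by ring
  have hle' := (sq_le_sq₀ (by positivity) (by positivity)).1 hle
  rcases hN.eq_or_lt with h0 | h0
  · rw [← h0]; positivity
  · exact le_of_mul_le_mul_left hle' h0

omit hQ in
theorem galerkinProj_mulVec (W : Matrix ι κ ℝ) (w : ι → ℝ) :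
    galerkinProj Q W *ᵥ w = W *ᵥ ((Wᵀ * Q * W)⁻¹ *ᵥ (Wᵀ *ᵥ (Q *ᵥ w))) := by
  simp only [galerkinProj, mulVec_mulVec, Matrix.mul_assoc]

/-- Pythagoras: `W z` is the `Q`-orthogonal projection of `w`, so the square of the norm drops by
exactly `‖W z‖² = z · y = yᵀ(WᵀQW)⁻¹y ≥ 0`. -/
theorem energyNorm_one_sub_galerkinProj_le {W : Matrix ι κ ℝ} (hW : (Wᵀ * Q * W).PosDef)
    (w : ι → ℝ) : energyNorm Q ((1 - galerkinProj Q W) *ᵥ w) ≤ energyNorm Q w := by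
  set y := Wᵀ *ᵥ (Q *ᵥ w) with hy
  set z := (Wᵀ * Q * W)⁻¹ *ᵥ y with hz
  have hi : (Wᵀ * Q * W) * (Wᵀ * Q * W)⁻¹ = 1 := mul_nonsing_inv _ hW.isUnit_det
  have e : (1 - galerkinProj Q W) *ᵥ w = w - W *ᵥ z := by
    rw [sub_mulVec, one_mulVec, galerkinProj_mulVec]
  have hmove : ∀ (a : κ → ℝ) (b : ι → ℝ), (W *ᵥ a) ⬝ᵥ b = a ⬝ᵥ Wᵀ *ᵥ b := by
    intro a b
    rw [dotProduct_mulVec, vecMul_transpose]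
  have e1 : (W *ᵥ z) ⬝ᵥ Q *ᵥ (W *ᵥ z) = z ⬝ᵥ y := by
    rw [hmove, mulVec_mulVec, mulVec_mulVec]
    nth_rw 2 [hz]
    rw [mulVec_mulVec, hi, one_mulVec]
  have e2 : (W *ᵥ z) ⬝ᵥ Q *ᵥ w = z ⬝ᵥ y := by rw [hmove]
  have e3 : w ⬝ᵥ Q *ᵥ (W *ᵥ z) = z ⬝ᵥ y := by
    rw [dotProduct_mulVec_symm hQ.posSemidef.isSymm, e2]
  have hpos : 0 ≤ z ⬝ᵥ y := by
    rw [hz, dotProduct_comm]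
    exact hW.inv.posSemidef.form_nonneg y
  rw [e]
  refine Real.sqrt_le_sqrt ?_
  rw [mulVec_sub, dotProduct_sub, sub_dotProduct, sub_dotProduct, e1, e2, e3]
  linarith

omit hQ in
-- The additive form of `P₂ P₁` hides a multiplicative two-level scheme: its error operator is a
-- `P`-step followed by a Galerkin correction.
theorem one_sub_overallPrecond_mul (P : Matrix ι ι ℝ) (W : Matrix ι κ ℝ) :
    1 - overallPrecond Q P W * Q = (1 - galerkinProj Q W) * (1 - P * Q) := by
  simp only [overallPrecond, galerkinProj, Matrix.add_mul, Matrix.sub_mul, Matrix.mul_sub,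
    Matrix.one_mul, Matrix.mul_one, Matrix.mul_assoc]
  abel

omit hQ in
theorem sub_outerIterate_succ (P : Matrix ι ι ℝ) (W : Matrix ι κ ℝ) {q u : ι → ℝ}
    (hu : Q *ᵥ u = q) (u₀ : ι → ℝ) (n : ℕ) :
    u - outerIterate Q P W q u₀ (n + 1) =
      ((1 - galerkinProj Q W) * (1 - P * Q)) *ᵥ (u - outerIterate Q P W q u₀ n) := by
  rw [← one_sub_overallPrecond_mul, outerIterate, ← hu, ← mulVec_sub, mulVec_mulVec,
    sub_mulVec, one_mulVec, ← neg_sub u, mulVec_neg]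
  abel

omit hQ in
theorem mem_upperBounds_contractionValues {P : Matrix ι ι ℝ} {W : Matrix ι κ ℝ} {c : ℝ}
    (hc : ∀ v, energyNorm Q (((1 - galerkinProj Q W) * (1 - P * Q)) *ᵥ v) ≤ c * energyNorm Q v) :
    c ∈ upperBounds (contractionValues Q P W) := by
  rintro y ⟨v, hv, rfl⟩
  simpa [hv] using hc v

variable [Nonempty ι]

/-- The empty set of reals has no least upper bound, so the supremum defining `η` is meaningful only
if a unit vector exists. -/
theorem contractionValues_nonempty (P : Matrix ι ι ℝ) (W : Matrix ι κ ℝ) :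
    (contractionValues Q P W).Nonempty := by
  obtain ⟨i⟩ := ‹Nonempty ι›
  have hx : (Pi.single i 1 : ι → ℝ) ≠ 0 := by simp
  have hpos := energyNorm_pos hQ hx
  refine ⟨_, (energyNorm Q (Pi.single i 1))⁻¹ • Pi.single i 1, ?_, rfl⟩
  rw [energyNorm_smul (inv_nonneg.2 hpos.le), inv_mul_cancel₀ hpos.ne']

/-- Convergence of the outer iteration, with the sharp contraction factor. -/
theorem exists_contraction_factor {P : Matrix ι ι ℝ} {W : Matrix ι κ ℝ} {c : ℝ} (hc1 : c < 1)
    (hc : ∀ v, energyNorm Q (((1 - galerkinProj Q W) * (1 - P * Q)) *ᵥ v) ≤ c * energyNorm Q v) :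
    ∃ η : ℝ, IsLUB (contractionValues Q P W) η ∧ 0 ≤ η ∧ η ≤ c ∧
      ∀ q u u₀ : ι → ℝ, Q *ᵥ u = q →
        (∀ n, energyNorm Q (u - outerIterate Q P W q u₀ (n + 1)) ≤
          η * energyNorm Q (u - outerIterate Q P W q u₀ n)) ∧
        Tendsto (outerIterate Q P W q u₀) atTop (𝓝 u) := by
  have hub := mem_upperBounds_contractionValues hc
  have hne := contractionValues_nonempty hQ P W
  have hlub := isLUB_csSup hne ⟨c, hub⟩
  set η := sSup (contractionValues Q P W)
  have hη0 : 0 ≤ η := by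
    obtain ⟨y, hy⟩ := hne
    refine le_trans ?_ (hlub.1 hy)
    obtain ⟨v, -, rfl⟩ := hy
    exact energyNorm_nonneg _
  have hηc : η ≤ c := hlub.2 hub
  refine ⟨η, hlub, hη0, hηc, fun q u u₀ hu => ?_⟩
  -- Homogeneity extends the bound from unit vectors to all `v`; `v = 0` cannot be normalized and is
  -- separate.
  have hstep : ∀ v, energyNorm Q (((1 - galerkinProj Q W) * (1 - P * Q)) *ᵥ v) ≤
      η * energyNorm Q v := by
    intro v
    by_cases hv : v = 0
    · simp [hv, energyNorm]
    have hpos := energyNorm_pos hQ hv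
    have := hlub.1 ⟨(energyNorm Q v)⁻¹ • v, by
      rw [energyNorm_smul (inv_nonneg.2 hpos.le), inv_mul_cancel₀ hpos.ne'], rfl⟩
    rw [mulVec_smul, energyNorm_smul (inv_nonneg.2 hpos.le)] at this
    rwa [← div_eq_inv_mul, div_le_iff₀ hpos] at this
  have hrec : ∀ n, energyNorm Q (u - outerIterate Q P W q u₀ (n + 1)) ≤
      η * energyNorm Q (u - outerIterate Q P W q u₀ n) := by
    intro n
    rw [sub_outerIterate_succ P W hu]
    exact hstep _
  refine ⟨hrec, tendsto_of_energyNorm_sub hQ ?_⟩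
  have hgeo : ∀ n, energyNorm Q (u - outerIterate Q P W q u₀ n) ≤
      η ^ n * energyNorm Q (u - u₀) := by
    intro n
    induction n with
    | zero => simp [outerIterate]
    | succ n ih =>
      calc _ ≤ _ := hrec n
        _ ≤ η * (η ^ n * energyNorm Q (u - u₀)) := by gcongr
        _ = _ := by ring
  refine squeeze_zero (fun n => energyNorm_nonneg _) hgeo ?_
  simpa using (tendsto_pow_atTop_nhds_zero_of_lt_one hη0 (hηc.trans_lt hc1)).mul_const
    (energyNorm Q (u - u₀))

end EnergyNorm

end LinearAlgebra

end RTE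

/-! ### Bounded measurable functions -/

namespace RTE

section BoundedMeasurable

variable {α β : Type*} [MeasurableSpace α] [MeasurableSpace β]

/-- Bounded measurable real functions. -/
def BddMeas (f : α → ℝ) : Prop := Measurable f ∧ ∃ C, ∀ a, |f a| ≤ C

namespace BddMeas

variable {f h : α → ℝ}

theorem const (c : ℝ) : BddMeas fun _ : α => c := ⟨measurable_const, |c|, fun _ => le_rfl⟩

theorem add (hf : BddMeas f) (hh : BddMeas h) : BddMeas fun a => f a + h a := by
  obtain ⟨mf, C, hC⟩ := hf
  obtain ⟨mh, C', hC'⟩ := hh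
  exact ⟨mf.add mh, C + C', fun a => (abs_add_le _ _).trans (add_le_add (hC a) (hC' a))⟩

theorem mul (hf : BddMeas f) (hh : BddMeas h) : BddMeas fun a => f a * h a := by
  obtain ⟨mf, C, hC⟩ := hf
  obtain ⟨mh, C', hC'⟩ := hh
  refine ⟨mf.mul mh, C * C', fun a => ?_⟩
  rw [abs_mul]
  exact mul_le_mul (hC a) (hC' a) (abs_nonneg _) ((abs_nonneg _).trans (hC a))

theorem sub (hf : BddMeas f) (hh : BddMeas h) : BddMeas fun a => f a - h a := by
  simpa [sub_eq_add_neg] using hf.add ((const (-1)).mul hh)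

theorem pow (hf : BddMeas f) (n : ℕ) : BddMeas fun a => f a ^ n := by
  induction n with
  | zero => simpa using const 1
  | succ n ih => simpa [pow_succ] using ih.mul hf

theorem sum {ι : Type*} (s : Finset ι) {F : ι → α → ℝ} (hF : ∀ i ∈ s, BddMeas (F i)) :
    BddMeas fun a => ∑ i ∈ s, F i a := by
  classical
  induction s using Finset.induction_on with
  | empty => simpa using const 0
  | insert i s hi ih =>
    simp only [Finset.sum_insert hi]
    exact (hF i (Finset.mem_insert_self _ _)).add
      (ih fun j hj => hF j (Finset.mem_insert_of_mem hj))

theorem prod {ι : Type*} (s : Finset ι) {F : ι → α → ℝ} (hF : ∀ i ∈ s, BddMeas (F i)) :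
    BddMeas fun a => ∏ i ∈ s, F i a := by
  classical
  induction s using Finset.induction_on with
  | empty => simpa using const 1
  | insert i s hi ih =>
    simp only [Finset.prod_insert hi]
    exact (hF i (Finset.mem_insert_self _ _)).mul
      (ih fun j hj => hF j (Finset.mem_insert_of_mem hj))

theorem comp (hf : BddMeas f) {φ : β → α} (hφ : Measurable φ) : BddMeas fun b => f (φ b) :=
  ⟨hf.1.comp hφ, hf.2.imp fun _ hC b => hC (φ b)⟩

theorem integrable (hf : BddMeas f) {μ : Measure α} [IsFiniteMeasure μ] : Integrable f μ := by
  obtain ⟨mf, C, hC⟩ := hf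
  exact Integrable.of_bound mf.aestronglyMeasurable C (Eventually.of_forall hC)

theorem of_continuous [TopologicalSpace α] [CompactSpace α] [OpensMeasurableSpace α]
    (hf : Continuous f) : BddMeas f := by
  obtain ⟨C, hC⟩ := isCompact_univ.exists_bound_of_continuousOn hf.continuousOn
  exact ⟨hf.measurable, C, fun a => hC a (Set.mem_univ a)⟩

/-- A function that vanishes off a measurable set and that is continuous and bounded on it. -/
theorem of_continuousOn [TopologicalSpace α] [OpensMeasurableSpace α] {U : Set α}
    (hU : MeasurableSet U) (hf : ContinuousOn f U) (h0 : ∀ a ∉ U, f a = 0)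
    {C : ℝ} (hC : ∀ a ∈ U, |f a| ≤ C) : BddMeas f := by
  classical
  refine ⟨?_, max C 0, fun a => ?_⟩
  · have : f = U.piecewise f 0 := by
      ext a
      by_cases ha : a ∈ U <;> simp [ha, h0]
    rw [this]
    exact hf.measurable_piecewise continuousOn_const hU
  · by_cases ha : a ∈ U
    · exact (hC a ha).trans (le_max_left _ _)
    · simp [h0 a ha]

end BddMeas

end BoundedMeasurable

/-! ### The surface measure of the sphere -/

instance : IsFiniteMeasure dS := inferInstanceAs (IsFiniteMeasure (volume : Measure E3).toSphere)

instance : dS.IsOpenPosMeasure :=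
  inferInstanceAs ((volume : Measure E3).toSphere.IsOpenPosMeasure)

/-- The homeomorphism of the sphere induced by a linear isometry. -/
noncomputable def sphMap (U : E3 ≃ₗᵢ[ℝ] E3) : Sph ≃ₜ Sph where
  toFun s := ⟨U s, by simp⟩
  invFun s := ⟨U.symm s, by simp⟩
  left_inv s := by simp
  right_inv s := by simp
  continuous_toFun := by fun_prop
  continuous_invFun := by fun_prop

@[simp] theorem coe_sphMap (U : E3 ≃ₗᵢ[ℝ] E3) (s : Sph) : (sphMap U s : E3) = U s := rfl

/-- The surface measure of `A` is a fixed multiple of the volume of the cone `(0, 1) • A`, and `U`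
maps cones to cones and preserves volume. -/
theorem measurePreserving_sphMap (U : E3 ≃ₗᵢ[ℝ] E3) : MeasurePreserving (sphMap U) dS dS := by
  refine ⟨(sphMap U).continuous.measurable, ?_⟩
  ext A hA
  rw [Measure.map_apply (sphMap U).continuous.measurable hA]
  have hA' : MeasurableSet (sphMap U ⁻¹' A) := (sphMap U).continuous.measurable hA
  rw [dS, Measure.toSphere_apply' _ hA', Measure.toSphere_apply' _ hA]
  congr 1
  have : Set.Ioo (0 : ℝ) 1 • ((↑) '' (sphMap U ⁻¹' A) : Set E3) =
      U ⁻¹' (Set.Ioo (0 : ℝ) 1 • ((↑) '' A : Set E3)) := by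
    ext x
    simp only [Set.mem_smul, Set.mem_image, Set.mem_preimage]
    constructor
    · rintro ⟨r, hr, _, ⟨s, hs, rfl⟩, rfl⟩
      exact ⟨r, hr, _, ⟨sphMap U s, hs, rfl⟩, by simp⟩
    · rintro ⟨r, hr, _, ⟨s, hs, rfl⟩, h⟩
      refine ⟨r, hr, _, ⟨(sphMap U).symm s, by simpa using hs, rfl⟩, ?_⟩
      have : x = U.symm (r • (s : E3)) := by rw [h]; simp
      rw [this, map_smul]
      rfl
  rw [this]
  exact U.measurePreserving.measure_preimage_emb U.toHomeomorph.measurableEmbedding _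

theorem integral_sphMap (U : E3 ≃ₗᵢ[ℝ] E3) (f : Sph → ℝ) :
    ∫ s, f (sphMap U s) ∂dS = ∫ s, f s ∂dS :=
  (measurePreserving_sphMap U).integral_comp (sphMap U).measurableEmbedding f

/-- Integration of a product of an angular and a radial function in polar coordinates. -/
theorem integral_eq_integral_sphere_mul {G : E3 → ℝ} {F : Sph → ℝ} {ρ : ℝ → ℝ}
    (h : ∀ (s : Sph) (r : ℝ), 0 < r → G (r • (s : E3)) = F s * ρ r) :
    ∫ x, G x = (∫ s, F s ∂dS) * ∫ r in Set.Ioi (0 : ℝ), r ^ 2 * ρ r := by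
  have hdim : Module.finrank ℝ E3 - 1 = 2 := by simp
  calc ∫ x, G x = ∫ x : ({(0)}ᶜ : Set E3), G x ∂(volume.comap Subtype.val) := by
        rw [integral_subtype_comap (measurableSet_singleton _).compl G, restrict_compl_singleton]
    _ = ∫ x, F x.1 * ρ x.2 ∂((volume : Measure E3).toSphere.prod (.volumeIoiPow 2)) := by
        have := ((volume : Measure E3).measurePreserving_homeomorphUnitSphereProd).integral_comp
          (Homeomorph.measurableEmbedding _) (fun p => F p.1 * ρ p.2)
        rw [hdim] at this
        rw [← this]
        refine integral_congr_ae (.of_forall fun x => ?_)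
        have hx : (x : E3) ≠ 0 := x.2
        have hx' : 0 < ‖(x : E3)‖ := norm_pos_iff.2 hx
        have e := h (homeomorphUnitSphereProd E3 x).1 ‖(x : E3)‖ hx'
        rw [homeomorphUnitSphereProd_apply_fst_coe, smul_smul, mul_inv_cancel₀ hx'.ne',
          one_smul] at e
        simp [e]
    _ = (∫ s, F s ∂dS) * ∫ r : Set.Ioi (0 : ℝ), ρ r ∂(.volumeIoiPow 2) :=
        integral_prod_mul F (fun r : Set.Ioi (0 : ℝ) => ρ r)
    _ = _ := by
        congr 1
        simp only [Measure.volumeIoiPow, ENNReal.ofReal]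
        rw [integral_withDensity_eq_integral_smul,
          integral_subtype_comap measurableSet_Ioi fun a ↦ Real.toNNReal (a ^ 2) • ρ a,
          setIntegral_congr_fun measurableSet_Ioi fun x hx ↦ ?_]
        · rw [NNReal.smul_def, Real.coe_toNNReal _ (pow_nonneg hx.out.le _), smul_eq_mul]
        · exact (measurable_subtype_coe.pow_const _).real_toNNReal

/-- The Gaussian factors over the coordinates; the two coordinates other than `e` contribute `√π`
each. -/
theorem integral_gaussian_moment (e : Fin 3) (n : ℕ) :
    ∫ x : E3, x e ^ n * Real.exp (-‖x‖ ^ 2) = (∫ t : ℝ, t ^ n * Real.exp (-t ^ 2)) * Real.pi := by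
  have h1 : ∀ x : Fin 3 → ℝ, x e ^ n * Real.exp (-‖(WithLp.toLp 2 x : E3)‖ ^ 2) =
      ∏ i, (if i = e then x i ^ n * Real.exp (-x i ^ 2) else Real.exp (-x i ^ 2)) := by
    intro x
    rw [EuclideanSpace.norm_sq_eq, ← Finset.sum_neg_distrib, Real.exp_sum,
      ← Finset.mul_prod_erase _ _ (Finset.mem_univ e),
      ← Finset.mul_prod_erase _ (fun i => ite (i = e) _ _) (Finset.mem_univ e), if_pos rfl]
    simp only [Real.norm_eq_abs, sq_abs, mul_assoc]
    congr 2
    refine Finset.prod_congr rfl fun i hi => ?_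
    rw [if_neg (Finset.ne_of_mem_erase hi)]
  have h2 := (EuclideanSpace.volume_preserving_symm_measurableEquiv_toLp (Fin 3)).integral_comp'
    (fun x : Fin 3 → ℝ => x e ^ n * Real.exp (-‖(WithLp.toLp 2 x : E3)‖ ^ 2))
  have h3 : ∫ x : E3, x e ^ n * Real.exp (-‖x‖ ^ 2) =
      ∫ x : Fin 3 → ℝ, x e ^ n * Real.exp (-‖(WithLp.toLp 2 x : E3)‖ ^ 2) := h2
  rw [h3]
  simp_rw [h1]
  rw [integral_fintype_prod_volume_eq_prod
    (f := fun i t => if i = e then t ^ n * Real.exp (-t ^ 2) else Real.exp (-t ^ 2)),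
    ← Finset.mul_prod_erase _ _ (Finset.mem_univ e)]
  simp only [if_true]
  congr 1
  have hg : ∫ t : ℝ, Real.exp (-t ^ 2) = √Real.pi := by simpa using integral_gaussian 1
  rw [Finset.prod_congr rfl (g := fun _ => √Real.pi) fun i hi => ?_]
  · simp [Real.sq_sqrt Real.pi_pos.le]
  · simp [Finset.ne_of_mem_erase hi, hg]

theorem exists_isometry_map_eq {v w : E3} (h : ‖v‖ = ‖w‖) : ∃ U : E3 ≃ₗᵢ[ℝ] E3, U v = w :=
  ⟨_, Submodule.reflection_sub h⟩

theorem integral_inner_congr (F : ℝ → ℝ) {e e' : E3} (h : ‖e‖ = ‖e'‖) :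
    ∫ s : Sph, F (inner ℝ e (s : E3)) ∂dS = ∫ s : Sph, F (inner ℝ e' (s : E3)) ∂dS := by
  obtain ⟨U, rfl⟩ := exists_isometry_map_eq h
  rw [← integral_sphMap U fun s => F (inner ℝ (U e) (s : E3))]
  simp

/-- By rotation invariance `e` may be a coordinate vector. The Gaussian moment is then computed
twice: Cartesian coordinates give `π Γ(m + 1/2)`, polar coordinates give the wanted integral times
`Γ(m + 3/2) / 2`, and `Γ(x + 1) = x Γ(x)` yields the quotient. -/
theorem integral_inner_pow_even {e : E3} (he : ‖e‖ = 1) (m : ℕ) :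
    ∫ s : Sph, inner ℝ e (s : E3) ^ (2 * m) ∂dS = 4 * Real.pi / (2 * m + 1) := by
  have he' : ‖e‖ = ‖(EuclideanSpace.single 0 1 : E3)‖ := by simp [he]
  rw [integral_inner_congr (fun t => t ^ (2 * m)) he']
  simp only [EuclideanSpace.inner_single_left, map_one, one_mul]
  have hK : ∀ j : ℕ, ∫ t in Set.Ioi (0 : ℝ), t ^ (2 * j) * Real.exp (-t ^ 2) =
      1 / 2 * Real.Gamma (j + 1 / 2) := by
    intro j
    have h := integral_rpow_mul_exp_neg_rpow (p := 2) (q := (2 * j : ℕ)) (by norm_num)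
      (by have : (0 : ℝ) ≤ (2 * j : ℕ) := Nat.cast_nonneg _
          linarith)
    have e : (((2 * j : ℕ) : ℝ) + 1) / 2 = j + 1 / 2 := by push_cast; ring
    rw [e] at h
    rw [← h]
    refine setIntegral_congr_fun measurableSet_Ioi fun t _ => ?_
    simp only [Real.rpow_natCast]
    norm_num
  have hpolar := integral_eq_integral_sphere_mul
    (G := fun x : E3 => x 0 ^ (2 * m) * Real.exp (-‖x‖ ^ 2))
    (F := fun s : Sph => (s : E3) 0 ^ (2 * m))
    (ρ := fun r => r ^ (2 * m) * Real.exp (-r ^ 2)) (by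
      intro s r hr
      have hs : ‖(s : E3)‖ = 1 := by simp
      simp only [PiLp.smul_apply, smul_eq_mul, mul_pow, norm_smul, hs, Real.norm_eq_abs, sq_abs]
      ring_nf)
  rw [integral_gaussian_moment] at hpolar
  have e1 : ∫ t : ℝ, t ^ (2 * m) * Real.exp (-t ^ 2) = Real.Gamma (m + 1 / 2) := by
    have h : ∫ t : ℝ, |t| ^ (2 * m) * Real.exp (-|t| ^ 2) =
        2 * ∫ t in Set.Ioi (0 : ℝ), t ^ (2 * m) * Real.exp (-t ^ 2) :=
      integral_comp_abs (f := fun t : ℝ => t ^ (2 * m) * Real.exp (-t ^ 2))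
    rw [hK m] at h
    simp only [(even_two_mul m).pow_abs, sq_abs] at h
    rw [h]
    ring
  have e2 : ∫ r in Set.Ioi (0 : ℝ), r ^ 2 * (r ^ (2 * m) * Real.exp (-r ^ 2)) =
      1 / 2 * ((m + 1 / 2) * Real.Gamma (m + 1 / 2)) := by
    have h := hK (m + 1)
    rw [show ((m + 1 : ℕ) : ℝ) + 1 / 2 = (m + 1 / 2) + 1 by push_cast; ring,
      Real.Gamma_add_one (by positivity)] at h
    rw [← h]
    refine setIntegral_congr_fun measurableSet_Ioi fun t _ => ?_
    ring
  rw [e1, e2] at hpolar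
  have hG : 0 < Real.Gamma ((m : ℝ) + 1 / 2) := Real.Gamma_pos_of_pos (by positivity)
  have hm : (0 : ℝ) < 2 * m + 1 := by positivity
  rw [eq_div_iff hm.ne']
  have : Real.Gamma ((m : ℝ) + 1 / 2) * (4 * Real.pi) = Real.Gamma ((m : ℝ) + 1 / 2) *
      ((∫ s : Sph, (s : E3) 0 ^ (2 * m) ∂dS) * (2 * m + 1)) := by
    linear_combination 4 * hpolar
  exact (mul_left_cancel₀ hG.ne' this).symm

theorem integral_inner_pow_odd (e : E3) (m : ℕ) :
    ∫ s : Sph, inner ℝ e (s : E3) ^ (2 * m + 1) ∂dS = 0 := by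
  have h := integral_sphMap (LinearIsometryEquiv.neg ℝ)
    fun s : Sph => inner ℝ e (s : E3) ^ (2 * m + 1)
  have : ∀ s : Sph, inner ℝ e (sphMap (LinearIsometryEquiv.neg ℝ) s : E3) ^ (2 * m + 1) =
      - inner ℝ e (s : E3) ^ (2 * m + 1) := by
    intro s
    simp [Odd.neg_pow ⟨m, rfl⟩]
  simp only [this, integral_neg] at h
  linarith

theorem integral_inner_pow {e : E3} (he : ‖e‖ = 1) (n : ℕ) :
    ∫ s : Sph, inner ℝ e (s : E3) ^ n ∂dS = 2 * Real.pi * ∫ t in (-1 : ℝ)..1, t ^ n := by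
  rw [integral_pow]
  obtain ⟨m, rfl | rfl⟩ := Nat.even_or_odd' n
  · rw [integral_inner_pow_even he, Odd.neg_one_pow ⟨m, rfl⟩]
    push_cast
    ring
  · rw [integral_inner_pow_odd, Even.neg_one_pow ⟨m + 1, by ring⟩]
    simp

theorem continuous_inner_sph (e : E3) : Continuous fun s : Sph => inner ℝ e (s : E3) := by
  fun_prop

theorem inner_sph_mem_Icc {e : E3} (he : ‖e‖ = 1) (s : Sph) :
    inner ℝ e (s : E3) ∈ Set.Icc (-1 : ℝ) 1 := by
  have h := abs_real_inner_le_norm e (s : E3)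
  have hs : ‖(s : E3)‖ = 1 := by simp
  rw [he, hs, one_mul] at h
  exact abs_le.1 h

theorem continuous_comp_inner {F : ℝ → ℝ} (hF : ContinuousOn F (Set.Icc (-1) 1)) {e : E3}
    (he : ‖e‖ = 1) : Continuous fun s : Sph => F (inner ℝ e (s : E3)) :=
  hF.comp_continuous (continuous_inner_sph e) (inner_sph_mem_Icc he)

theorem integral_inner_polynomial {e : E3} (he : ‖e‖ = 1) (p : Polynomial ℝ) :
    ∫ s : Sph, p.eval (inner ℝ e (s : E3)) ∂dS = 2 * Real.pi * ∫ t in (-1 : ℝ)..1, p.eval t := by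
  induction p using Polynomial.induction_on' with
  | add p q hp hq =>
    simp only [Polynomial.eval_add]
    rw [integral_add, intervalIntegral.integral_add, hp, hq, mul_add]
    · exact p.continuous.intervalIntegrable _ _
    · exact q.continuous.intervalIntegrable _ _
    · exact (BddMeas.of_continuous (p.continuous.comp (continuous_inner_sph e))).integrable
    · exact (BddMeas.of_continuous (q.continuous.comp (continuous_inner_sph e))).integrable
  | monomial n a =>
    simp only [Polynomial.eval_monomial]
    rw [integral_const_mul, intervalIntegral.integral_const_mul, integral_inner_pow he]
    ring

theorem dS_real_univ : dS.real Set.univ = 4 * Real.pi := by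
  have h := integral_inner_pow_even (e := EuclideanSpace.single 0 1) (by simp) 0
  simpa using h

/-- Archimedes' theorem: the coordinate of a uniformly distributed point of the sphere in a fixed
direction is uniformly distributed. -/
theorem integral_comp_inner {F : ℝ → ℝ} (hF : ContinuousOn F (Set.Icc (-1) 1)) {e : E3}
    (he : ‖e‖ = 1) :
    ∫ s : Sph, F (inner ℝ e (s : E3)) ∂dS = 2 * Real.pi * ∫ t in (-1 : ℝ)..1, F t := by
  have hpi := Real.pi_pos
  rw [← sub_eq_zero, ← abs_nonpos_iff]
  refine le_of_forall_pos_le_add fun δ hδ => ?_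
  -- Weierstrass approximation reduces to polynomials. The sphere has mass `4π` and `2π` times the
  -- length of the interval is also `4π`, so each side changes by at most `δ / 2`.
  obtain ⟨p, hp⟩ := exists_polynomial_near_of_continuousOn (-1) 1 F hF (δ / (8 * Real.pi))
    (by positivity)
  have hFi : IntervalIntegrable F volume (-1) 1 :=
    ContinuousOn.intervalIntegrable (by simpa using hF)
  have hi := integral_inner_polynomial he p
  have b1 : |∫ s : Sph, p.eval (inner ℝ e (s : E3)) ∂dS - ∫ s : Sph, F (inner ℝ e (s : E3)) ∂dS| ≤
      δ / 2 := by
    have hpc : Continuous fun s : Sph => p.eval (inner ℝ e (s : E3)) :=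
      p.continuous.comp (continuous_inner_sph e)
    rw [← integral_sub (BddMeas.of_continuous hpc).integrable
      (BddMeas.of_continuous (continuous_comp_inner hF he)).integrable]
    have := norm_integral_le_of_norm_le_const (μ := dS) (C := δ / (8 * Real.pi))
      (f := fun s : Sph => p.eval (inner ℝ e (s : E3)) - F (inner ℝ e (s : E3)))
      (Eventually.of_forall fun s => (hp _ (inner_sph_mem_Icc he s)).le)
    rw [dS_real_univ, Real.norm_eq_abs] at this
    refine this.trans (le_of_eq ?_)
    field_simp
    ring
  have b2 : |(∫ t in (-1 : ℝ)..1, p.eval t) - ∫ t in (-1 : ℝ)..1, F t| ≤ δ / (4 * Real.pi) := by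
    rw [← intervalIntegral.integral_sub (p.continuous.intervalIntegrable _ _) hFi]
    have := intervalIntegral.norm_integral_le_of_norm_le_const (a := -1) (b := 1)
      (C := δ / (8 * Real.pi)) (f := fun t => p.eval t - F t) (fun t ht => (hp t (by
        rw [Set.uIoc_of_le (by norm_num)] at ht
        exact ⟨ht.1.le, ht.2⟩)).le)
    rw [Real.norm_eq_abs] at this
    refine this.trans (le_of_eq ?_)
    rw [show |(1 : ℝ) - -1| = 2 by norm_num]
    field_simp
    norm_num
  have b3 : |2 * Real.pi * (∫ t in (-1 : ℝ)..1, p.eval t) -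
      2 * Real.pi * ∫ t in (-1 : ℝ)..1, F t| ≤ δ / 2 := by
    rw [← mul_sub, abs_mul, abs_of_pos (by positivity : 0 < 2 * Real.pi)]
    calc _ ≤ 2 * Real.pi * (δ / (4 * Real.pi)) := by gcongr
      _ = δ / 2 := by field_simp; norm_num
  rw [hi] at b1
  rw [abs_le] at b1 b3 ⊢
  constructor <;> linarith [b1.1, b1.2, b3.1, b3.2]

end RTE

/-! ### The phase function -/

namespace RTE

open Set

theorem _root_.Ring.multichoose_nonneg {a : ℝ} (ha : 0 < a) (n : ℕ) : 0 ≤ Ring.multichoose a n := by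
  have h := Ring.factorial_nsmul_multichoose_eq_ascPochhammer a n
  rw [Polynomial.ascPochhammer_smeval_eq_eval] at h
  have hp := ascPochhammer_pos n a ha
  rw [← h, nsmul_eq_mul] at hp
  exact (pos_of_mul_pos_right hp (Nat.cast_nonneg _)).le

namespace Medium

variable {d : ℕ} (M : Medium d)

/-- The base equals `(1 - g)² + 2g(1 - t)`. -/
theorem phase_base_pos {t : ℝ} (ht : t ≤ 1) : 0 < 1 - 2 * M.g * t + M.g ^ 2 := by
  have h0 := M.g_nonneg
  have h1 := M.g_lt_one
  nlinarith [mul_nonneg h0 (sub_nonneg.2 ht), mul_pos (sub_pos.2 h1) (sub_pos.2 h1)]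

theorem one_sub_g_sq_pos : 0 < 1 - M.g ^ 2 := by
  have h0 := M.g_nonneg
  have h1 := M.g_lt_one
  nlinarith

theorem phase_nonneg {t : ℝ} (ht : t ≤ 1) : 0 ≤ M.phase t := by
  have h := M.phase_base_pos ht
  have h2 := M.one_sub_g_sq_pos
  have := Real.pi_pos
  unfold phase
  positivity

theorem contDiffOn_phase : ContDiffOn ℝ 1 M.phase (Icc (-1) 1) := by
  unfold phase
  refine contDiffOn_const.mul (contDiffOn_const.div ?_ fun t ht => ?_)
  · refine ContDiffOn.rpow_const_of_ne (by fun_prop) fun t ht => (M.phase_base_pos ht.2).ne'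
  · exact (Real.rpow_pos_of_pos (M.phase_base_pos ht.2) _).ne'

theorem continuousOn_phase : ContinuousOn M.phase (Icc (-1) 1) :=
  M.contDiffOn_phase.continuousOn

/-- Forward peaking, from `g ≥ 0`. It fixes the sign of the kernel antisymmetrized by a reflection.
-/
theorem phase_mono {t t' : ℝ} (h : t ≤ t') (h1 : t' ≤ 1) : M.phase t ≤ M.phase t' := by
  have hb := M.phase_base_pos h1
  have h2 := M.one_sub_g_sq_pos
  have hg := M.g_nonneg
  have := Real.pi_pos
  unfold phase
  gcongr

/-- Needed to divide the antisymmetrized kernel by its zero factor on the mirror plane and keep a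
bounded function. -/
theorem exists_lipschitz_phase : ∃ L : ℝ, ∀ t ∈ Icc (-1 : ℝ) 1, ∀ t' ∈ Icc (-1 : ℝ) 1,
    |M.phase t - M.phase t'| ≤ L * |t - t'| := by
  obtain ⟨K, hK⟩ := M.contDiffOn_phase.exists_lipschitzOnWith one_ne_zero (convex_Icc _ _)
    isCompact_Icc
  exact ⟨K, fun t ht t' ht' => hK.dist_le_mul t ht t' ht'⟩

/-- The phase function has a power series with nonnegative coefficients. -/
theorem exists_hasSum_phase : ∃ b : ℕ → ℝ, (∀ n, 0 ≤ b n) ∧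
    ∀ t ∈ Icc (-1 : ℝ) 1, HasSum (fun n => b n * t ^ n) (M.phase t) := by
  have hg0 := M.g_nonneg
  have hg1 := M.g_lt_one
  have h2 := M.one_sub_g_sq_pos
  have hpi := Real.pi_pos
  have hD : 0 < 1 + M.g ^ 2 := by positivity
  -- The base factors as `(1 + g²)(1 - a t)`. Since `(1 - g)² > 0` gives `a < 1`, the binomial
  -- series of `(1 - x)^(-3/2)` at `x = a t` converges on all of `[-1, 1]`, endpoints included.
  set a := 2 * M.g / (1 + M.g ^ 2) with ha
  have ha0 : 0 ≤ a := by positivity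
  have ha1 : a < 1 := by
    rw [ha, div_lt_one hD]
    nlinarith [mul_pos (sub_pos.2 hg1) (sub_pos.2 hg1)]
  set B := 1 / (4 * Real.pi) * ((1 - M.g ^ 2) / (1 + M.g ^ 2) ^ (3 / 2 : ℝ)) with hB
  have hB0 : 0 ≤ B := by positivity
  refine ⟨fun n => B * (Ring.multichoose (3 / 2 : ℝ) n * a ^ n), fun n => ?_, fun t ht => ?_⟩
  · have := Ring.multichoose_nonneg (a := 3 / 2) (by norm_num) n
    positivity
  · have hat : |a * t| < 1 := by
      rw [abs_mul, abs_of_nonneg ha0]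
      calc a * |t| ≤ a * 1 := by gcongr; exact abs_le.2 ht
        _ < 1 := by simpa using ha1
    have hs := (Real.one_div_one_sub_rpow_hasFPowerSeriesOnBall_zero (3 / 2)).hasSum (y := a * t)
      (by
        rw [Metric.mem_eball, edist_dist, Real.dist_eq, sub_zero]
        exact ENNReal.ofReal_lt_one.2 hat)
    simp only [FormalMultilinearSeries.ofScalars_apply_eq, zero_add, smul_eq_mul,
      ← Ring.multichoose_eq] at hs
    have e1 : 1 - 2 * M.g * t + M.g ^ 2 = (1 + M.g ^ 2) * (1 - a * t) := by
      rw [ha]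
      field_simp
      ring
    have h1at : 0 ≤ 1 - a * t := by linarith [(abs_lt.1 hat).2]
    have e2 : M.phase t = B * (1 / (1 - a * t) ^ (3 / 2 : ℝ)) := by
      rw [phase, e1, Real.mul_rpow hD.le h1at, hB]
      field_simp
    rw [e2]
    have := hs.mul_left B
    refine this.congr_fun fun n => ?_
    ring

theorem phase_eq {t : ℝ} (ht : t ≤ 1) : M.phase t = (1 - M.g ^ 2) / (4 * Real.pi) *
    ((1 - 2 * M.g * t + M.g ^ 2) * √(1 - 2 * M.g * t + M.g ^ 2))⁻¹ := by
  have hb := M.phase_base_pos ht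
  have : (1 - 2 * M.g * t + M.g ^ 2) ^ (3 / 2 : ℝ) =
      (1 - 2 * M.g * t + M.g ^ 2) * √(1 - 2 * M.g * t + M.g ^ 2) := by
    rw [Real.sqrt_eq_rpow, show (3 / 2 : ℝ) = 1 + 1 / 2 by norm_num, Real.rpow_add hb,
      Real.rpow_one]
  rw [phase, this]
  field_simp

theorem hasDerivAt_sqrt_base {t : ℝ} (ht : t ≤ 1) :
    HasDerivAt (fun t => √(1 - 2 * M.g * t + M.g ^ 2))
      (-M.g / √(1 - 2 * M.g * t + M.g ^ 2)) t := by
  have hb := M.phase_base_pos ht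
  have h1 : HasDerivAt (fun t => 1 - 2 * M.g * t + M.g ^ 2) (-(2 * M.g)) t := by
    simpa using ((hasDerivAt_id t).const_mul (2 * M.g)).const_sub 1 |>.add_const (M.g ^ 2)
  convert h1.sqrt hb.ne' using 1
  field_simp

theorem sqrt_base_one : √(1 - 2 * M.g * 1 + M.g ^ 2) = 1 - M.g := by
  rw [show 1 - 2 * M.g * 1 + M.g ^ 2 = (1 - M.g) ^ 2 by ring]
  exact Real.sqrt_sq (by linarith [M.g_lt_one])

theorem sqrt_base_neg_one : √(1 - 2 * M.g * (-1) + M.g ^ 2) = 1 + M.g := by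
  rw [show 1 - 2 * M.g * (-1) + M.g ^ 2 = (1 + M.g) ^ 2 by ring]
  exact Real.sqrt_sq (by linarith [M.g_nonneg])

/-- With `r = √(1 - 2gt + g²)` one has `r' = -g/r`, so `1/(g r)` is an antiderivative of `1/r³`; at
the endpoints `r = 1 ∓ g`. The division by `g` makes the isotropic case separate. -/
theorem integral_phase : 2 * Real.pi * ∫ t in (-1 : ℝ)..1, M.phase t = 1 := by
  have hpi := Real.pi_pos
  rcases M.g_nonneg.eq_or_lt with h0 | h0
  · have : M.phase = fun _ => 1 / (4 * Real.pi) := by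
      ext t
      simp [phase, ← h0]
    rw [this, intervalIntegral.integral_const]
    simp only [smul_eq_mul]
    field_simp
    norm_num
  have hd : ∀ t ∈ uIcc (-1 : ℝ) 1, HasDerivAt
      (fun t => (1 - M.g ^ 2) / (4 * Real.pi) * (M.g⁻¹ * (√(1 - 2 * M.g * t + M.g ^ 2))⁻¹))
      (M.phase t) t := by
    intro t ht
    rw [uIcc_of_le (by norm_num)] at ht
    have hb := M.phase_base_pos ht.2
    have hs : 0 < √(1 - 2 * M.g * t + M.g ^ 2) := Real.sqrt_pos.2 hb
    rw [M.phase_eq ht.2]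
    refine HasDerivAt.const_mul _ ?_
    convert! ((M.hasDerivAt_sqrt_base ht.2).inv hs.ne').const_mul M.g⁻¹ using 1
    have e := Real.sq_sqrt hb.le
    set r := √(1 - 2 * M.g * t + M.g ^ 2)
    rw [← e]
    field_simp
  rw [intervalIntegral.integral_eq_sub_of_hasDerivAt hd
    (ContinuousOn.intervalIntegrable (by simpa using M.continuousOn_phase))]
  rw [M.sqrt_base_one, M.sqrt_base_neg_one]
  have h1 : 1 - M.g ≠ 0 := by linarith [M.g_lt_one]
  have h2 : 1 + M.g ≠ 0 := by linarith
  field_simp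
  ring

/-- Integration by parts suggests the antiderivative `t/(g r) + r/g²` of `t/r³`, again with `g = 0`
apart. This mean cosine is the eigenvalue of the scattering operator on linear forms. -/
theorem integral_phase_mul : 2 * Real.pi * ∫ t in (-1 : ℝ)..1, M.phase t * t = M.g := by
  have hpi := Real.pi_pos
  rcases M.g_nonneg.eq_or_lt with h0 | h0
  · have : M.phase = fun _ => 1 / (4 * Real.pi) := by
      ext t
      simp [phase, ← h0]
    rw [this, intervalIntegral.integral_const_mul, integral_id, ← h0]
    norm_num
  have hd : ∀ t ∈ uIcc (-1 : ℝ) 1, HasDerivAt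
      (fun t => (1 - M.g ^ 2) / (4 * Real.pi) *
        (M.g⁻¹ * (t * (√(1 - 2 * M.g * t + M.g ^ 2))⁻¹) +
          (M.g ^ 2)⁻¹ * √(1 - 2 * M.g * t + M.g ^ 2)))
      (M.phase t * t) t := by
    intro t ht
    rw [uIcc_of_le (by norm_num)] at ht
    have hb := M.phase_base_pos ht.2
    have hs : 0 < √(1 - 2 * M.g * t + M.g ^ 2) := Real.sqrt_pos.2 hb
    rw [M.phase_eq ht.2, mul_assoc]
    refine HasDerivAt.const_mul _ ?_
    convert! (((hasDerivAt_id t).mul ((M.hasDerivAt_sqrt_base ht.2).inv hs.ne')).const_mul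
      M.g⁻¹).add ((M.hasDerivAt_sqrt_base ht.2).const_mul (M.g ^ 2)⁻¹) using 1
    have e := Real.sq_sqrt hb.le
    simp only [id, Pi.inv_apply]
    set r := √(1 - 2 * M.g * t + M.g ^ 2)
    rw [← e]
    field_simp
    ring
  rw [intervalIntegral.integral_eq_sub_of_hasDerivAt hd
    (ContinuousOn.intervalIntegrable
      (by
        rw [uIcc_of_le (by norm_num)]
        exact M.continuousOn_phase.mul continuousOn_id))]
  rw [M.sqrt_base_one, M.sqrt_base_neg_one]
  have h1 : 1 - M.g ≠ 0 := by linarith [M.g_lt_one]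
  have h2 : 1 + M.g ≠ 0 := by linarith
  field_simp
  ring

/-! ### The scattering form -/

theorem norm_coe_sph (s : Sph) : ‖(s : E3)‖ = 1 := by simp

theorem integral_phase_inner (s : Sph) :
    ∫ s' : Sph, M.phase (inner ℝ (s : E3) (s' : E3)) ∂dS = 1 := by
  rw [integral_comp_inner M.continuousOn_phase (norm_coe_sph s), integral_phase]

theorem continuous_phase_inner (s : Sph) :
    Continuous fun s' : Sph => M.phase (inner ℝ (s : E3) (s' : E3)) :=
  continuous_comp_inner M.continuousOn_phase (norm_coe_sph s)

/-- Linear forms are eigenfunctions of the scattering operator with eigenvalue `g`. -/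
theorem integral_phase_inner_mul (s : Sph) (e : E3) :
    ∫ s' : Sph, M.phase (inner ℝ (s : E3) (s' : E3)) * inner ℝ e (s' : E3) ∂dS =
      M.g * inner ℝ e (s : E3) := by
  set a := inner ℝ e (s : E3) with ha
  -- Split `e` into its component along `s`, which gives the mean cosine `g`, and `b ⊥ s`, which
  -- contributes nothing.
  set b := e - a • (s : E3) with hb
  have hss : inner ℝ (s : E3) (s : E3) = (1 : ℝ) := by simp
  have hbs : inner ℝ (s : E3) b = (0 : ℝ) := by
    rw [hb, inner_sub_right, inner_smul_right, hss, ha, real_inner_comm]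
    ring
  have h1 : ∫ s' : Sph, M.phase (inner ℝ (s : E3) (s' : E3)) * inner ℝ (s : E3) (s' : E3) ∂dS =
      M.g := by
    rw [integral_comp_inner (F := fun t => M.phase t * t)
      (M.continuousOn_phase.mul continuousOn_id) (norm_coe_sph s), integral_phase_mul]
  have h2 : ∫ s' : Sph, M.phase (inner ℝ (s : E3) (s' : E3)) * inner ℝ b (s' : E3) ∂dS = 0 := by
    -- The half-turn about the axis `s` fixes the kernel and changes the sign of the factor `b ·
    -- s'`.
    set V := (ℝ ∙ (s : E3)).reflection
    have hV : ∀ x y, inner ℝ x (V y) = inner ℝ (V x) y := fun x y => by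
      rw [← V.inner_map_map (V x) y, Submodule.reflection_reflection]
    have hVs : V (s : E3) = s :=
      Submodule.reflection_mem_subspace_eq_self (Submodule.mem_span_singleton_self _)
    have hVb : V b = -b :=
      Submodule.reflection_mem_subspace_orthogonalComplement_eq_neg
        (Submodule.mem_orthogonal_singleton_iff_inner_right.2 hbs)
    have h := integral_sphMap V
      fun s' => M.phase (inner ℝ (s : E3) (s' : E3)) * inner ℝ b (s' : E3)
    simp only [coe_sphMap, hV, hVs, hVb, inner_neg_left, mul_neg, integral_neg] at h
    linarith
  have e1 : ∀ s' : Sph, inner ℝ e (s' : E3) =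
      a * inner ℝ (s : E3) (s' : E3) + inner ℝ b (s' : E3) := by
    intro s'
    rw [hb, inner_sub_left, inner_smul_left]
    simp
  simp only [e1, mul_add]
  rw [integral_add, h2, add_zero]
  · rw [← h1, mul_comm, ← integral_const_mul]
    congr 1
    ext s'
    ring
  · exact ((BddMeas.of_continuous (M.continuous_phase_inner s)).mul
      ((BddMeas.const a).mul (BddMeas.of_continuous (continuous_inner_sph s)))).integrable
  · exact ((BddMeas.of_continuous (M.continuous_phase_inner s)).mul
      (BddMeas.of_continuous (continuous_inner_sph b))).integrable

/-- The kernel `k(s·s')` of the scattering operator. -/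
noncomputable def kernel (p : Sph × Sph) : ℝ := M.phase (inner ℝ (p.1 : E3) (p.2 : E3))

theorem inner_mem_Icc (s s' : Sph) : inner ℝ (s : E3) (s' : E3) ∈ Icc (-1 : ℝ) 1 :=
  inner_sph_mem_Icc (norm_coe_sph s) s'

theorem bddMeas_kernel : BddMeas M.kernel := by
  refine BddMeas.of_continuous (M.continuousOn_phase.comp_continuous (by fun_prop) fun p => ?_)
  exact inner_mem_Icc p.1 p.2

theorem kernel_swap (p : Sph × Sph) : M.kernel p.swap = M.kernel p := by
  simp [kernel, real_inner_comm]

theorem kernel_nonneg (p : Sph × Sph) : 0 ≤ M.kernel p := M.phase_nonneg (inner_mem_Icc p.1 p.2).2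

/-- The bilinear form `(f, h) ↦ ∫_S f (𝒮 h)`. -/
noncomputable def scatForm (f h : Sph → ℝ) : ℝ :=
  ∫ p, M.kernel p * (f p.1 * h p.2) ∂(dS.prod dS)

variable {f h : Sph → ℝ}

theorem bddMeas_tensor (hf : BddMeas f) (hh : BddMeas h) :
    BddMeas fun p : Sph × Sph => f p.1 * h p.2 :=
  (hf.comp measurable_fst).mul (hh.comp measurable_snd)

theorem integral_scatter_mul (hf : BddMeas f) (hh : BddMeas h) :
    ∫ s, M.scatter f s * h s ∂dS = M.scatForm h f := by
  rw [scatForm, integral_prod _ (M.bddMeas_kernel.mul (bddMeas_tensor hh hf)).integrable]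
  congr 1
  ext s
  rw [scatter, ← integral_mul_const]
  congr 1
  ext s'
  simp only [kernel]
  ring

theorem scatForm_comm (f h : Sph → ℝ) : M.scatForm f h = M.scatForm h f := by
  rw [scatForm, ← integral_prod_swap]
  simp only [kernel_swap, Prod.fst_swap, Prod.snd_swap, mul_comm (f _), scatForm]

/-- Apply `f(s) f(s') ≤ (f(s)² + f(s')²) / 2` under the nonnegative symmetric kernel, whose integral
in either variable is one. -/
theorem scatForm_self_le (hf : BddMeas f) : M.scatForm f f ≤ ∫ s, f s ^ 2 ∂dS := by
  have h1 : ∫ p, M.kernel p * f p.1 ^ 2 ∂(dS.prod dS) = ∫ s, f s ^ 2 ∂dS := by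
    rw [integral_prod _ (M.bddMeas_kernel.mul ((hf.comp measurable_fst).pow 2)).integrable]
    congr 1
    ext s
    simp only [kernel]
    rw [integral_mul_const, integral_phase_inner, one_mul]
  have h2 : ∫ p, M.kernel p * f p.2 ^ 2 ∂(dS.prod dS) = ∫ s, f s ^ 2 ∂dS := by
    rw [← h1, ← integral_prod_swap]
    simp only [kernel_swap, Prod.snd_swap]
  have i1 : BddMeas fun p => M.kernel p * f p.1 ^ 2 :=
    M.bddMeas_kernel.mul ((hf.comp measurable_fst).pow 2)
  have i2 : BddMeas fun p => M.kernel p * f p.2 ^ 2 :=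
    M.bddMeas_kernel.mul ((hf.comp measurable_snd).pow 2)
  have h3 : M.scatForm f f ≤
      ∫ p, (1 / 2) * (M.kernel p * f p.1 ^ 2 + M.kernel p * f p.2 ^ 2) ∂(dS.prod dS) := by
    refine integral_mono (M.bddMeas_kernel.mul (bddMeas_tensor hf hf)).integrable
      ((BddMeas.const _).mul (i1.add i2)).integrable fun p => ?_
    have := mul_nonneg (M.kernel_nonneg p) (sq_nonneg (f p.1 - f p.2))
    simp only
    linarith
  rw [integral_const_mul, integral_add i1.integrable i2.integrable, h1, h2] at h3
  linarith

/-- Expanding `(s · s')ⁿ` over multi-indices separates the variables into equal factors, so the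
double integral is a sum of squares. -/
theorem integral_inner_pow_mul_nonneg (hf : BddMeas f) (n : ℕ) :
    0 ≤ ∫ p : Sph × Sph, inner ℝ (p.1 : E3) (p.2 : E3) ^ n * (f p.1 * f p.2) ∂(dS.prod dS) := by
  have hc : ∀ i : Fin 3, BddMeas fun s : Sph => (s : E3) i := fun i =>
    BddMeas.of_continuous (by fun_prop)
  have e : ∀ p : Sph × Sph, inner ℝ (p.1 : E3) (p.2 : E3) ^ n * (f p.1 * f p.2) =
      ∑ q : Fin n → Fin 3, ((∏ j, (p.1 : E3) (q j)) * f p.1) *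
        ((∏ j, (p.2 : E3) (q j)) * f p.2) := by
    intro p
    rw [PiLp.inner_apply, Fintype.sum_pow, Finset.sum_mul]
    refine Finset.sum_congr rfl fun q _ => ?_
    rw [show (∏ j, (p.1 : E3) (q j)) * f p.1 * ((∏ j, (p.2 : E3) (q j)) * f p.2) =
      ((∏ j, (p.1 : E3) (q j)) * (∏ j, (p.2 : E3) (q j))) * (f p.1 * f p.2) by ring,
      ← Finset.prod_mul_distrib]
    simp [mul_comm]
  have hb : ∀ q : Fin n → Fin 3, BddMeas fun s : Sph => (∏ j, (s : E3) (q j)) * f s := fun q =>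
    (BddMeas.prod _ fun j _ => hc (q j)).mul hf
  simp only [e]
  rw [integral_finsetSum _ fun q _ => (bddMeas_tensor (hb q) (hb q)).integrable]
  refine Finset.sum_nonneg fun q _ => ?_
  rw [integral_prod_mul (fun s : Sph => (∏ j, (s : E3) (q j)) * f s)
    (fun s : Sph => (∏ j, (s : E3) (q j)) * f s)]
  exact mul_self_nonneg _

/-- Integrate the power series of the kernel term by term; every term is nonnegative. Convergence at
`t = 1` makes the coefficients summable, which supplies the dominating series. -/
theorem scatForm_self_nonneg (hf : BddMeas f) : 0 ≤ M.scatForm f f := by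
  obtain ⟨b, hb0, hb⟩ := M.exists_hasSum_phase
  obtain ⟨C, hC⟩ := (bddMeas_tensor hf hf).2
  have hsum : Summable b := by simpa using (hb 1 (by norm_num)).summable
  have hk : ∀ n, BddMeas fun p : Sph × Sph => inner ℝ (p.1 : E3) (p.2 : E3) ^ n := fun n =>
    (BddMeas.of_continuous (by fun_prop)).pow n
  have h := hasSum_integral_of_dominated_convergence (μ := dS.prod dS)
    (F := fun n p => b n * (inner ℝ (p.1 : E3) (p.2 : E3) ^ n * (f p.1 * f p.2)))
    (f := fun p => M.kernel p * (f p.1 * f p.2)) (fun n _ => b n * C)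
    (fun n => ((BddMeas.const (b n)).mul
      ((hk n).mul (bddMeas_tensor hf hf))).1.aestronglyMeasurable)
    (fun n => .of_forall fun p => ?_) (.of_forall fun _ => hsum.mul_right C)
    (integrable_const _) (.of_forall fun p => ?_)
  · refine h.nonneg fun n => ?_
    rw [integral_const_mul]
    exact mul_nonneg (hb0 n) (integral_inner_pow_mul_nonneg hf n)
  · rw [Real.norm_eq_abs, abs_mul, abs_of_nonneg (hb0 n), abs_mul, abs_pow]
    refine mul_le_mul_of_nonneg_left ?_ (hb0 n)
    calc _ ≤ 1 * |f p.1 * f p.2| := by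
          gcongr
          exact pow_le_one₀ (abs_nonneg _) (abs_le.2 (inner_mem_Icc p.1 p.2))
      _ ≤ C := by rw [one_mul]; exact hC p
  · have := (hb _ (inner_mem_Icc p.1 p.2)).mul_right (f p.1 * f p.2)
    refine this.congr_fun fun n => ?_
    ring

end Medium

end RTE

/-! ### The spectral bound of the scattering operator on odd functions -/

namespace RTE

open Set

/-- The reflection of `ℝ³` in the plane orthogonal to `e`. -/
noncomputable def planeRefl (e : E3) : E3 ≃ₗᵢ[ℝ] E3 := (ℝ ∙ e)ᗮ.reflection

theorem planeRefl_apply {e : E3} (he : ‖e‖ = 1) (x : E3) :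
    planeRefl e x = x - (2 * inner ℝ e x) • e := by
  have h := Submodule.reflection_orthogonal_apply (K := ℝ ∙ e) x
  rw [planeRefl, h, Submodule.reflection_singleton_apply, he]
  simp [two_smul, two_mul, add_smul]

theorem planeRefl_planeRefl (e x : E3) : planeRefl e (planeRefl e x) = x :=
  Submodule.reflection_reflection _ x

theorem sphMap_planeRefl_sphMap (e : E3) (s : Sph) :
    sphMap (planeRefl e) (sphMap (planeRefl e) s) = s :=
  Subtype.ext (planeRefl_planeRefl e s)

theorem planeRefl_single (i j : Fin 3) (x : E3) :
    planeRefl (EuclideanSpace.single i 1) x j = if j = i then -x j else x j := by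
  rw [planeRefl_apply (by simp)]
  by_cases h : j = i
  · subst h
    simp [EuclideanSpace.inner_single_left]
    ring
  · simp [h]

namespace Medium

variable {d : ℕ} (M : Medium d) {f : Sph → ℝ}

theorem scatForm_sphMap (U : E3 ≃ₗᵢ[ℝ] E3) (f h : Sph → ℝ) :
    M.scatForm (fun s => f (sphMap U s)) (fun s => h (sphMap U s)) = M.scatForm f h := by
  have hmp := (measurePreserving_sphMap U).prod (measurePreserving_sphMap U)
  have hemb : MeasurableEmbedding (Prod.map (sphMap U) (sphMap U)) :=
    ((sphMap U).prodCongr (sphMap U)).measurableEmbedding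
  refine Eq.trans ?_ (hmp.integral_comp hemb fun p => M.kernel p * (f p.1 * h p.2))
  simp [kernel, scatForm]

/-- On functions that are odd with respect to a reflection, the scattering form is bounded by
`g`: the kernel antisymmetrized by the reflection is nonnegative with respect to the ground state
`s ↦ e · s`. -/
theorem scatForm_self_le_of_antisymm (hf : BddMeas f) {e : E3} (he : ‖e‖ = 1)
    (hfe : ∀ s, f (sphMap (planeRefl e) s) = -f s) :
    M.scatForm f f ≤ M.g * ∫ s, f s ^ 2 ∂dS := by
  obtain ⟨L, hL⟩ := M.exists_lipschitz_phase
  set U := planeRefl e with hU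
  set w : Sph → ℝ := fun s => inner ℝ e (s : E3) with hw
  have hwm : BddMeas w := BddMeas.of_continuous (continuous_inner_sph e)
  have hUinner : ∀ p : Sph × Sph, inner ℝ (p.1 : E3) (sphMap U p.2 : E3) =
      inner ℝ (p.1 : E3) (p.2 : E3) - 2 * (w p.1 * w p.2) := by
    intro p
    rw [coe_sphMap, hU, planeRefl_apply he, inner_sub_right, inner_smul_right,
      real_inner_comm e]
    simp only [hw]
    ring
  have hUm : Measurable fun p : Sph × Sph => ((p.1, sphMap U p.2) : Sph × Sph) :=
    measurable_fst.prodMk ((sphMap U).continuous.measurable.comp measurable_snd)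
  -- On antisymmetric functions this kernel produces the same form as the original one.
  set κ : Sph × Sph → ℝ := fun p => 1 / 2 * (M.kernel p - M.kernel (p.1, sphMap U p.2)) with hκ
  have hκm : BddMeas κ :=
    (BddMeas.const _).mul (M.bddMeas_kernel.sub (M.bddMeas_kernel.comp hUm))
  set ww : Sph × Sph → ℝ := fun p => w p.1 * w p.2 with hww
  -- Where `ww` vanishes the quotient is `0` by convention; this is harmless because `κ` vanishes
  -- there too.
  set m : Sph × Sph → ℝ := fun p => κ p / ww p with hm
  have hκ0 : ∀ p, ww p = 0 → κ p = 0 := by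
    intro p hp
    simp only [hκ, kernel, hUinner]
    rw [hww] at hp
    simp only at hp
    rw [hp]
    simp
  have hκm_eq : ∀ p, κ p = m p * ww p := by
    intro p
    by_cases hp : ww p = 0
    · rw [hκ0 p hp, hp, mul_zero]
    · rw [hm, div_mul_cancel₀ _ hp]
  have hκabs : ∀ p, |κ p| ≤ |L| * |ww p| := by
    intro p
    have h := hL _ (inner_mem_Icc p.1 p.2) _ (inner_mem_Icc p.1 (sphMap U p.2))
    rw [hUinner] at h
    have e1 : κ p = 1 / 2 * (M.phase (inner ℝ (p.1 : E3) (p.2 : E3)) -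
        M.phase (inner ℝ (p.1 : E3) (p.2 : E3) - 2 * (w p.1 * w p.2))) := by
      simp only [hκ, kernel, hUinner]
    rw [e1, abs_mul, abs_of_pos (by norm_num : (0 : ℝ) < 1 / 2)]
    rw [sub_sub_cancel, abs_mul, abs_of_pos (by norm_num : (0 : ℝ) < 2)] at h
    have h' : L * (2 * |w p.1 * w p.2|) ≤ |L| * (2 * |ww p|) := by
      gcongr
      exact le_abs_self L
    linarith
  -- Reflecting `s'` lowers the cosine by `2 w(s) w(s')`, so by monotonicity of the phase function
  -- `κ` has the sign of `ww`.
  have hm0 : ∀ p, 0 ≤ m p := by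
    intro p
    have h1 := (inner_mem_Icc p.1 p.2).2
    have h2 := (inner_mem_Icc p.1 (sphMap U p.2)).2
    rcases le_total 0 (ww p) with hp | hp
    · refine div_nonneg ?_ hp
      have : M.kernel (p.1, sphMap U p.2) ≤ M.kernel p := by
        refine M.phase_mono ?_ h1
        simp only
        rw [hUinner]
        linarith
      simp only [hκ]
      linarith
    · refine div_nonneg_of_nonpos ?_ hp
      have : M.kernel p ≤ M.kernel (p.1, sphMap U p.2) := by
        refine M.phase_mono ?_ h2
        simp only
        rw [hUinner]
        linarith
      simp only [hκ]
      linarith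
  have hmm : BddMeas m := by
    refine ⟨hκm.1.div ((hwm.1.comp measurable_fst).mul (hwm.1.comp measurable_snd)), |L|,
      fun p => ?_⟩
    rw [hm]
    simp only
    rw [abs_div]
    exact div_le_of_le_mul₀ (abs_nonneg _) (abs_nonneg _) (hκabs p)
  have hmswap : ∀ p : Sph × Sph, m p.swap = m p := by
    intro p
    have e1 : ww p.swap = ww p := by simp only [hww, Prod.fst_swap, Prod.snd_swap, mul_comm]
    have e2 : κ p.swap = κ p := by
      have h := hUinner p.swap
      simp only [Prod.fst_swap, Prod.snd_swap] at h
      simp only [hκ, kernel_swap]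
      congr 2
      simp only [kernel, Prod.fst_swap, Prod.snd_swap]
      rw [h, hUinner, real_inner_comm, mul_comm (w p.2)]
    simp only [hm, e1, e2]
  -- the form in terms of the antisymmetrized kernel
  have hform : M.scatForm f f = ∫ p, m p * ((w p.1 * f p.2) * (w p.2 * f p.1)) ∂(dS.prod dS) := by
    have hmp := (MeasurePreserving.id dS).prod (measurePreserving_sphMap U)
    have hemb : MeasurableEmbedding (Prod.map id (sphMap U) : Sph × Sph → Sph × Sph) :=
      ((Homeomorph.refl Sph).prodCongr (sphMap U)).measurableEmbedding
    have h1 : ∫ p, M.kernel (p.1, sphMap U p.2) * (f p.1 * f p.2) ∂(dS.prod dS) =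
        -M.scatForm f f := by
      rw [scatForm, ← integral_neg]
      refine (Eq.trans ?_ (hmp.integral_comp hemb
        (fun p => -(M.kernel p * (f p.1 * f p.2)))))
      congr 1
      ext p
      simp only [id, hfe, Prod.map]
      ring
    have h2 : ∫ p, κ p * (f p.1 * f p.2) ∂(dS.prod dS) = M.scatForm f f := by
      have e1 : ∀ p, κ p * (f p.1 * f p.2) = 1 / 2 * (M.kernel p * (f p.1 * f p.2) -
          M.kernel (p.1, sphMap U p.2) * (f p.1 * f p.2)) := by
        intro p
        simp only [hκ]
        ring
      simp only [e1]
      rw [integral_const_mul, integral_sub, h1, ← scatForm]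
      · ring
      · exact (M.bddMeas_kernel.mul (bddMeas_tensor hf hf)).integrable
      · exact ((M.bddMeas_kernel.comp hUm).mul (bddMeas_tensor hf hf)).integrable
    rw [← h2]
    congr 1
    ext p
    rw [hκm_eq]
    simp only [hww]
    ring
  have b1 : BddMeas fun p : Sph × Sph => m p * (w p.2 * f p.1) ^ 2 :=
    hmm.mul (((hwm.comp measurable_snd).mul (hf.comp measurable_fst)).pow 2)
  have b2 : BddMeas fun p : Sph × Sph => m p * (w p.1 * f p.2) ^ 2 :=
    hmm.mul (((hwm.comp measurable_fst).mul (hf.comp measurable_snd)).pow 2)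
  have b3 : BddMeas fun p : Sph × Sph => m p * ((w p.1 * f p.2) * (w p.2 * f p.1)) :=
    hmm.mul (((hwm.comp measurable_fst).mul (hf.comp measurable_snd)).mul
      ((hwm.comp measurable_snd).mul (hf.comp measurable_fst)))
  -- Ground-state identity: `w` is antisymmetric and an eigenfunction of eigenvalue `g`, so `w(s)`
  -- times the integral is `g w(s)`. Equality holds off the mirror plane; on it `m` is zero and only
  -- the inequality remains.
  have hground : ∀ s, ∫ s', m (s, s') * w s' ^ 2 ∂dS ≤ M.g := by
    intro s
    have hms : Measurable fun s' : Sph => (s, s') := measurable_prodMk_left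
    by_cases hs : w s = 0
    · have : ∀ s', m (s, s') = 0 := fun s' => by simp [hm, hww, hs]
      simpa [this] using M.g_nonneg
    · refine le_of_eq (mul_left_cancel₀ hs ?_)
      rw [← integral_const_mul]
      have e1 : ∀ s', w s * (m (s, s') * w s' ^ 2) = κ (s, s') * w s' := by
        intro s'
        rw [hκm_eq]
        simp only [hww]
        ring
      have hker : ∫ s', M.kernel (s, s') * w s' ∂dS = M.g * w s := M.integral_phase_inner_mul s e
      have e2 : ∫ s', M.kernel (s, sphMap U s') * w s' ∂dS = -(M.g * w s) := by
        have hwU : ∀ s', w (sphMap U s') = -w s' := by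
          intro s'
          simp only [hw, coe_sphMap, hU, planeRefl_apply he, inner_sub_right, inner_smul_right]
          rw [real_inner_self_eq_norm_sq, he]
          ring
        have h := integral_sphMap U fun s' => M.kernel (s, s') * w s'
        simp only [hwU, mul_neg, integral_neg] at h
        rw [hker] at h
        linarith
      simp only [e1, hκ]
      have e3 : ∀ s', 1 / 2 * (M.kernel (s, s') - M.kernel (s, sphMap U s')) * w s' =
          1 / 2 * (M.kernel (s, s') * w s' - M.kernel (s, sphMap U s') * w s') := fun s' => by ring
      simp only [e3]
      rw [integral_const_mul, integral_sub, e2, hker]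
      · ring
      · exact ((M.bddMeas_kernel.comp hms).mul hwm).integrable
      · exact (((M.bddMeas_kernel.comp hUm).comp hms).mul hwm).integrable
  have hI1 : ∫ p : Sph × Sph, m p * (w p.2 * f p.1) ^ 2 ∂(dS.prod dS) ≤
      M.g * ∫ s, f s ^ 2 ∂dS := by
    rw [integral_prod _ b1.integrable, ← integral_const_mul]
    refine integral_mono b1.integrable.integral_prod_left
      ((BddMeas.const _).mul (hf.pow 2)).integrable fun s => ?_
    have e1 : ∀ s', m (s, s') * (w s' * f s) ^ 2 = f s ^ 2 * (m (s, s') * w s' ^ 2) :=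
      fun s' => by ring
    simp only [e1]
    rw [integral_const_mul, mul_comm]
    exact mul_le_mul_of_nonneg_right (hground s) (sq_nonneg _)
  have hI2 : ∫ p : Sph × Sph, m p * (w p.1 * f p.2) ^ 2 ∂(dS.prod dS) =
      ∫ p : Sph × Sph, m p * (w p.2 * f p.1) ^ 2 ∂(dS.prod dS) := by
    rw [← integral_prod_swap]
    simp only [hmswap, Prod.fst_swap, Prod.snd_swap]
  -- Weighted Schur test: `2xy ≤ x² + y²` with `x = w(s) f(s')` and `y = w(s') f(s)`, under the
  -- weight `m ≥ 0`.
  have hle : M.scatForm f f ≤ ∫ p, 1 / 2 * (m p * (w p.1 * f p.2) ^ 2 +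
      m p * (w p.2 * f p.1) ^ 2) ∂(dS.prod dS) := by
    rw [hform]
    refine integral_mono b3.integrable ((BddMeas.const _).mul (b2.add b1)).integrable fun p => ?_
    have := mul_nonneg (hm0 p) (sq_nonneg (w p.1 * f p.2 - w p.2 * f p.1))
    simp only
    linarith
  rw [integral_const_mul, integral_add b2.integrable b1.integrable, hI2] at hle
  linarith

/-- A bound of the scattering form can be verified separately on the components that are symmetric
and antisymmetric with respect to a reflection. -/
theorem scatForm_self_le_of_split (hf : BddMeas f) (e : E3)
    (hm : M.scatForm (fun s => 1 / 2 * (f s - f (sphMap (planeRefl e) s)))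
      (fun s => 1 / 2 * (f s - f (sphMap (planeRefl e) s))) ≤
      M.g * ∫ s, (1 / 2 * (f s - f (sphMap (planeRefl e) s))) ^ 2 ∂dS)
    (hp : M.scatForm (fun s => 1 / 2 * (f s + f (sphMap (planeRefl e) s)))
      (fun s => 1 / 2 * (f s + f (sphMap (planeRefl e) s))) ≤
      M.g * ∫ s, (1 / 2 * (f s + f (sphMap (planeRefl e) s))) ^ 2 ∂dS) :
    M.scatForm f f ≤ M.g * ∫ s, f s ^ 2 ∂dS := by
  set U := planeRefl e
  set f' : Sph → ℝ := fun s => f (sphMap U s) with hf'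
  have hfm' : BddMeas f' := hf.comp (sphMap U).continuous.measurable
  have b1 : BddMeas fun s => 1 / 2 * (f s - f' s) := (BddMeas.const _).mul (hf.sub hfm')
  have b2 : BddMeas fun s => 1 / 2 * (f s + f' s) := (BddMeas.const _).mul (hf.add hfm')
  have hn : ∫ s, f' s ^ 2 ∂dS = ∫ s, f s ^ 2 ∂dS := integral_sphMap U fun s => f s ^ 2
  have hs : M.scatForm f' f' = M.scatForm f f := M.scatForm_sphMap U f f
  -- Parallelogram law: the mixed terms cancel, and `f'` has the same form and norm as `f` by
  -- invariance.
  have e1 : M.scatForm (fun s => 1 / 2 * (f s - f' s)) (fun s => 1 / 2 * (f s - f' s)) +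
      M.scatForm (fun s => 1 / 2 * (f s + f' s)) (fun s => 1 / 2 * (f s + f' s)) =
      1 / 2 * (M.scatForm f f + M.scatForm f' f') := by
    rw [scatForm, scatForm, scatForm, scatForm,
      ← integral_add (M.bddMeas_kernel.mul (bddMeas_tensor b1 b1)).integrable
        (M.bddMeas_kernel.mul (bddMeas_tensor b2 b2)).integrable,
      ← integral_add (M.bddMeas_kernel.mul (bddMeas_tensor hf hf)).integrable
        (M.bddMeas_kernel.mul (bddMeas_tensor hfm' hfm')).integrable, ← integral_const_mul]
    congr 1
    ext p
    ring
  have e2 : ∫ s, (1 / 2 * (f s - f' s)) ^ 2 ∂dS + ∫ s, (1 / 2 * (f s + f' s)) ^ 2 ∂dS =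
      1 / 2 * (∫ s, f s ^ 2 ∂dS + ∫ s, f' s ^ 2 ∂dS) := by
    rw [← integral_add (b1.pow 2).integrable (b2.pow 2).integrable,
      ← integral_add (hf.pow 2).integrable (hfm'.pow 2).integrable, ← integral_const_mul]
    congr 1
    ext s
    ring
  rw [hs] at e1
  rw [hn] at e2
  have := add_le_add hm hp
  rw [e1, ← mul_add, e2] at this
  linarith

/-- The eigenvalues of the scattering operator on odd functions are at most `g`. -/
theorem scatForm_self_le_of_odd (hf : BddMeas f) (hodd : ∀ s, f (-s) = -f s) :
    M.scatForm f f ≤ M.g * ∫ s, f s ^ 2 ∂dS := by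
  have hn : ∀ i : Fin 3, ‖(EuclideanSpace.single i 1 : E3)‖ = 1 := fun i => by simp
  set R : Fin 3 → Sph → Sph := fun i => sphMap (planeRefl (EuclideanSpace.single i 1)) with hR
  have hRR : ∀ i s, R i (R i s) = s := fun i s => sphMap_planeRefl_sphMap _ s
  have hcoord : ∀ i j s, (R i s : E3) j = if j = i then -(s : E3) j else (s : E3) j :=
    fun i j s => planeRefl_single i j s
  -- The three coordinate reflections compose to the antipodal map, so any two of them give minus
  -- the third.
  have h2 : ∀ s, R 0 (R 1 s) = -R 2 s := by
    intro s
    ext j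
    fin_cases j <;> simp [hcoord]
  have h1 : ∀ s, R 1 s = -R 0 (R 2 s) := by
    intro s
    ext j
    fin_cases j <;> simp [hcoord]
  have h0 : ∀ s, R 0 s = -R 1 (R 2 s) := by
    intro s
    ext j
    fin_cases j <;> simp [hcoord]
  have hRm : ∀ i, Measurable (R i) := fun i => (sphMap _).continuous.measurable
  have anti : ∀ i {h : Sph → ℝ}, BddMeas h →
      M.scatForm (fun s => 1 / 2 * (h s - h (R i s))) (fun s => 1 / 2 * (h s - h (R i s))) ≤
      M.g * ∫ s, (1 / 2 * (h s - h (R i s))) ^ 2 ∂dS := by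
    intro i h hh
    refine M.scatForm_self_le_of_antisymm ((BddMeas.const _).mul (hh.sub (hh.comp (hRm i))))
      (hn i) fun s => ?_
    have := hRR i s
    simp only [hR] at this ⊢
    rw [this]
    ring
  -- Split off the antisymmetric parts for the first two reflections. The rest is symmetric under
  -- both, and oddness then makes it antisymmetric under the third.
  refine M.scatForm_self_le_of_split hf (EuclideanSpace.single 0 1) (anti 0 hf) ?_
  have b0 : BddMeas fun s => 1 / 2 * (f s + f (R 0 s)) :=
    (BddMeas.const _).mul (hf.add (hf.comp (hRm 0)))
  refine M.scatForm_self_le_of_split b0 (EuclideanSpace.single 1 1) (anti 1 b0) ?_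
  have b1 : BddMeas fun s => 1 / 2 * (1 / 2 * (f s + f (R 0 s)) +
      1 / 2 * (f (R 1 s) + f (R 0 (R 1 s)))) :=
    (BddMeas.const _).mul (b0.add (b0.comp (hRm 1)))
  refine M.scatForm_self_le_of_antisymm b1 (hn 2) fun s => ?_
  have e0 : f (R 0 s) = -f (R 1 (R 2 s)) := by rw [h0, hodd]
  have e1 : f (R 1 s) = -f (R 0 (R 2 s)) := by rw [h1, hodd]
  have e2 : f (R 0 (R 1 s)) = -f (R 2 s) := by rw [h2, hodd]
  have e3 : f (R 0 (R 1 (R 2 s))) = -f s := by rw [h2, hodd, hRR]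
  change 1 / 2 * (1 / 2 * (f (R 2 s) + f (R 0 (R 2 s))) +
    1 / 2 * (f (R 1 (R 2 s)) + f (R 0 (R 1 (R 2 s))))) = _
  rw [e0, e1, e2, e3]
  ring

end Medium

end RTE

/-! ### Gram matrices -/

namespace RTE

open Set

section Gram

set_option linter.unusedSectionVars false

variable {α ι : Type*} [MeasurableSpace α] {μ : Measure α} [Fintype ι]

theorem BddMeas.of_iUnion [TopologicalSpace α] [OpensMeasurableSpace α] {κ : Type*} [Finite κ]
    {U : κ → Set α} {f : α → ℝ} (hU : ∀ k, IsOpen (U k)) (hf : ∀ k, ContinuousOn f (U k))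
    (h0 : ∀ a, (∀ k, a ∉ U k) → f a = 0) (hC : ∀ k, ∃ C, ∀ a ∈ U k, |f a| ≤ C) : BddMeas f := by
  choose C hC using hC
  obtain ⟨B, hB⟩ := (Set.finite_range C).bddAbove
  refine BddMeas.of_continuousOn (isOpen_iUnion hU).measurableSet
    (ContinuousOn.iUnion_of_isOpen hf hU) (fun a ha => h0 a ?_) (C := B) fun a ha => ?_
  · simpa using ha
  · obtain ⟨k, hk⟩ := mem_iUnion.1 ha
    exact (hC k a hk).trans (hB (mem_range_self k))

theorem integrable_mul_bddMeas {w h : α → ℝ} (hw : Integrable w μ) (hh : BddMeas h) :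
    Integrable (fun a => w a * h a) μ := by
  obtain ⟨mh, C, hC⟩ := hh
  exact hw.mul_bdd (c := C) mh.aestronglyMeasurable (Eventually.of_forall hC)

theorem integrable_mul_bddMeas_mul {w h h' : α → ℝ} (hw : Integrable w μ) (hh : BddMeas h)
    (hh' : BddMeas h') : Integrable (fun a => w a * h a * h' a) μ := by
  simpa only [mul_assoc] using integrable_mul_bddMeas hw (hh.mul hh')

theorem mul_sum_sq_eq (c : ℝ) (x F : ι → ℝ) :
    c * (∑ i, x i * F i) ^ 2 = ∑ i, ∑ j, x i * (x j * (c * F i * F j)) := by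
  rw [sq, Finset.sum_mul_sum, Finset.mul_sum]
  refine Finset.sum_congr rfl fun i _ => ?_
  rw [Finset.mul_sum]
  exact Finset.sum_congr rfl fun j _ => by ring

variable {w : α → ℝ} {F : ι → α → ℝ}

theorem integrable_mul_sum_sq (hint : ∀ i j, Integrable (fun a => w a * F i a * F j a) μ)
    (x : ι → ℝ) : Integrable (fun a => w a * (∑ i, x i * F i a) ^ 2) μ := by
  simp only [mul_sum_sq_eq]
  exact integrable_finsetSum _ fun i _ => integrable_finsetSum _ fun j _ =>
    ((hint i j).const_mul _).const_mul _

theorem dotProduct_gram_mulVec (hint : ∀ i j, Integrable (fun a => w a * F i a * F j a) μ)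
    (x : ι → ℝ) :
    x ⬝ᵥ (Matrix.of fun i j => ∫ a, w a * F i a * F j a ∂μ) *ᵥ x =
      ∫ a, w a * (∑ i, x i * F i a) ^ 2 ∂μ := by
  simp only [mul_sum_sq_eq]
  rw [integral_finsetSum _ fun i _ => integrable_finsetSum _ fun j _ =>
    ((hint i j).const_mul _).const_mul _]
  simp only [dotProduct, mulVec, Matrix.of_apply, Finset.mul_sum]
  refine Finset.sum_congr rfl fun i _ => ?_
  rw [integral_finsetSum _ fun j _ => ((hint i j).const_mul _).const_mul _]
  refine Finset.sum_congr rfl fun j _ => ?_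
  rw [integral_const_mul, integral_const_mul]
  ring

theorem gram_isSymm (μ : Measure α) (w : α → ℝ) (F : ι → α → ℝ) :
    (Matrix.of fun i j => ∫ a, w a * F i a * F j a ∂μ).IsSymm := by
  ext i j
  simp only [transpose_apply, Matrix.of_apply, mul_right_comm]

theorem gram_posSemidef (hw : ∀ᵐ a ∂μ, 0 ≤ w a)
    (hint : ∀ i j, Integrable (fun a => w a * F i a * F j a) μ) :
    (Matrix.of fun i j => ∫ a, w a * F i a * F j a ∂μ).PosSemidef := by
  refine posSemidef_real_iff.2 ⟨gram_isSymm _ _ _, fun x => ?_⟩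
  rw [dotProduct_gram_mulVec hint]
  exact integral_nonneg_of_ae (hw.mono fun a ha => mul_nonneg ha (sq_nonneg _))

/-- The form is the weighted integral of a square. The hypothesis `hF` is linear independence modulo
null sets; the bases at hand satisfy it because their combinations are continuous on open sets that
determine them. -/
theorem gram_posDef (hw : ∀ᵐ a ∂μ, 0 < w a)
    (hint : ∀ i j, Integrable (fun a => w a * F i a * F j a) μ)
    (hF : ∀ x : ι → ℝ, (fun a => ∑ i, x i * F i a) =ᵐ[μ] 0 → x = 0) :
    (Matrix.of fun i j => ∫ a, w a * F i a * F j a ∂μ).PosDef := by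
  refine posDef_real_iff.2 ⟨gram_isSymm _ _ _, fun x hx => ?_⟩
  have h0 : 0 ≤ᵐ[μ] fun a => w a * (∑ i, x i * F i a) ^ 2 :=
    hw.mono fun a ha => mul_nonneg ha.le (sq_nonneg _)
  rw [dotProduct_gram_mulVec hint]
  refine (integral_nonneg_of_ae h0).lt_of_ne fun h => hx (hF x ?_)
  have := (integral_eq_zero_iff_of_nonneg_ae h0 (integrable_mul_sum_sq hint x)).1 h.symm
  filter_upwards [this, hw] with a ha hwa
  simpa [hwa.ne'] using ha

theorem sum_mul_basis_mem {P : Submodule ℝ (α → ℝ)} (b : Module.Basis ι ℝ P) (x : ι → ℝ) :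
    (fun a => ∑ i, x i * (b i : α → ℝ) a) ∈ P := by
  have : (fun a => ∑ i, x i * (b i : α → ℝ) a) = ((∑ i, x i • b i : P) : α → ℝ) := by
    ext a
    simp
  rw [this]
  exact Subtype.mem _

theorem eq_zero_of_sum_mul_basis_eq_zero {P : Submodule ℝ (α → ℝ)} (b : Module.Basis ι ℝ P)
    {x : ι → ℝ} (h : (fun a => ∑ i, x i * (b i : α → ℝ) a) = 0) : x = 0 := by
  have h' : ∑ i, x i • b i = 0 := by
    apply Subtype.ext
    ext a
    simpa using congrFun h a
  exact funext (Fintype.linearIndependent_iff.1 b.linearIndependent x h')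

end Gram

/-! ### The angular matrices -/

section Sphere

variable {v : Fin 3 → E3}

theorem sphTriangleInt_subset (v : Fin 3 → E3) : sphTriangleInt v ⊆ sphTriangle v :=
  fun _ ⟨t, ht, h⟩ => ⟨t, fun i => (ht i).le, h⟩

/-- The basis of `ℝ³` formed by the vertices of a nondegenerate spherical triangle. -/
noncomputable def vertexBasis (hv : LinearIndependent ℝ v) : Module.Basis (Fin 3) ℝ E3 :=
  basisOfLinearIndependentOfCardEqFinrank hv (by simp)

/-- Describes spherical triangles by sign conditions on continuous coordinates, from which openness
and compactness follow. -/
theorem coe_eq_sum_iff (hv : LinearIndependent ℝ v) (s : E3) (t : Fin 3 → ℝ) :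
    s = ∑ i, t i • v i ↔ ∀ i, (vertexBasis hv).coord i s = t i := by
  have hb : ⇑(vertexBasis hv) = v := by simp [vertexBasis]
  constructor
  · rintro rfl i
    have e : ∀ j, v j = vertexBasis hv j := fun j => (congrFun hb j).symm
    simp only [e]
    simp [Finsupp.single_apply]
  · intro h
    conv_lhs => rw [← (vertexBasis hv).sum_repr s]
    refine Finset.sum_congr rfl fun i _ => ?_
    rw [← h i, hb, Module.Basis.coord_apply]

theorem continuous_coord_sph (hv : LinearIndependent ℝ v) (i : Fin 3) :
    Continuous fun s : Sph => (vertexBasis hv).coord i (s : E3) :=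
  (LinearMap.continuous_of_finiteDimensional _).comp continuous_subtype_val

theorem isOpen_sphTriangleInt (hv : LinearIndependent ℝ v) : IsOpen (sphTriangleInt v) := by
  have : sphTriangleInt v = ⋂ i, {s : Sph | 0 < (vertexBasis hv).coord i (s : E3)} := by
    ext s
    simp only [sphTriangleInt, mem_ofPred_eq, coe_eq_sum_iff hv, mem_iInter]
    constructor
    · rintro ⟨t, ht, h⟩ i
      rw [h i]
      exact ht i
    · exact fun h => ⟨_, h, fun i => rfl⟩
  rw [this]
  exact isOpen_iInter_of_finite fun i => isOpen_lt continuous_const (continuous_coord_sph hv i)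

theorem isCompact_sphTriangle (hv : LinearIndependent ℝ v) : IsCompact (sphTriangle v) := by
  have : sphTriangle v = ⋂ i, {s : Sph | 0 ≤ (vertexBasis hv).coord i (s : E3)} := by
    ext s
    simp only [sphTriangle, mem_ofPred_eq, coe_eq_sum_iff hv, mem_iInter]
    constructor
    · rintro ⟨t, ht, h⟩ i
      rw [h i]
      exact ht i
    · exact fun h => ⟨_, h, fun i => rfl⟩
  rw [this]
  exact (isClosed_iInter fun i =>
    isClosed_le continuous_const (continuous_coord_sph hv i)).isCompact

theorem sphTriangleInt_nonempty (hv : LinearIndependent ℝ v) : (sphTriangleInt v).Nonempty := by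
  have hx : ∑ i, v i ≠ 0 := by
    intro h
    have := Fintype.linearIndependent_iff.1 hv (fun _ => 1) (by simpa using h) 0
    exact one_ne_zero this
  have hpos : 0 < ‖∑ i, v i‖ := norm_pos_iff.2 hx
  refine ⟨⟨‖∑ i, v i‖⁻¹ • ∑ i, v i, ?_⟩, fun _ => ‖∑ i, v i‖⁻¹, fun _ => inv_pos.2 hpos, ?_⟩
  · simp [norm_smul, hpos.ne']
  · simp [Finset.smul_sum]

end Sphere

namespace SphereMesh

variable {m : ℕ} (T : SphereMesh m)

theorem isOpen_mu_support (k : Fin m) :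
    IsOpen (sphTriangleInt (T.vertex k) ∪ -sphTriangleInt (T.vertex k)) :=
  (isOpen_sphTriangleInt (T.nondegenerate k)).union
    ((isOpen_sphTriangleInt (T.nondegenerate k)).preimage (by fun_prop))

theorem bddMeas_mu (k : Fin m) : BddMeas (T.mu k) := by
  classical
  refine ⟨measurable_const.indicator (T.isOpen_mu_support k).measurableSet, 1, fun s => ?_⟩
  rw [mu, indicator_apply]
  split_ifs <;> simp

theorem sum_mul_mu_apply (x : Fin m → ℝ) {k : Fin m} {s : Sph}
    (hs : s ∈ sphTriangleInt (T.vertex k)) : ∑ j, x j * T.mu j s = x k := by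
  rw [Finset.sum_eq_single k]
  · simp [mu, hs]
  · intro j _ hj
    have h1 : s ∉ sphTriangleInt (T.vertex j) := fun h =>
      (disjoint_left.1 (T.disjoint_same j k hj) h hs)
    have h2 : s ∉ -sphTriangleInt (T.vertex j) := fun h =>
      disjoint_left.1 (T.disjoint_opposite k j) hs h
    simp [mu, h1, h2]
  · simp

/-- The combination is constant, equal to `x k`, on the interior of the `k`-th triangle, a nonempty
open set and hence of positive measure. -/
theorem eq_zero_of_sum_mul_mu (x : Fin m → ℝ)
    (h : (fun s => ∑ j, x j * T.mu j s) =ᵐ[dS] 0) : x = 0 := by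
  ext k
  have hU := isOpen_sphTriangleInt (T.nondegenerate k)
  obtain ⟨s, hs⟩ := sphTriangleInt_nonempty (T.nondegenerate k)
  have hc : ContinuousOn (fun s => ∑ j, x j * T.mu j s) (sphTriangleInt (T.vertex k)) :=
    continuousOn_const.congr fun s hs => T.sum_mul_mu_apply x hs
  have := Measure.eqOn_open_of_ae_eq (ae_restrict_of_ae h) hU hc continuousOn_const hs
  exact (T.sum_mul_mu_apply x hs).symm.trans this

variable {P : Fin m → Submodule ℝ (Sph → ℝ)}
  (hP : ∀ k, ∀ p ∈ P k, ContinuousOn p (sphTriangle (T.vertex k)))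
include hP

theorem continuousOn_of_mem_oddSpace {f : Sph → ℝ} (hf : f ∈ T.oddSpace P) (k : Fin m) :
    ContinuousOn f (sphTriangleInt (T.vertex k)) := by
  obtain ⟨p, hp, hfp⟩ := hf.2.1 k
  exact ((hP k p hp).mono (sphTriangleInt_subset _)).congr hfp

/-- Shape functions are continuous on the compact closed triangle, hence bounded; oddness carries
this to the opposite elements. -/
theorem bddMeas_of_mem_oddSpace {f : Sph → ℝ} (hf : f ∈ T.oddSpace P) : BddMeas f := by
  have hodd : ∀ s, f s = -f (-s) := fun s => by rw [hf.1, neg_neg]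
  have hbd : ∀ k, ∃ C, ∀ s ∈ sphTriangleInt (T.vertex k), |f s| ≤ C := by
    intro k
    obtain ⟨p, hp, hfp⟩ := hf.2.1 k
    obtain ⟨C, hC⟩ := (isCompact_sphTriangle (T.nondegenerate k)).exists_bound_of_continuousOn
      (hP k p hp)
    exact ⟨C, fun s hs => by rw [hfp hs]; exact hC s (sphTriangleInt_subset _ hs)⟩
  refine BddMeas.of_iUnion T.isOpen_mu_support (fun k => ?_) (fun s hs => ?_) fun k => ?_
  · have h1 := T.continuousOn_of_mem_oddSpace hP hf k
    have hU := isOpen_sphTriangleInt (T.nondegenerate k)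
    have hU' : IsOpen (-sphTriangleInt (T.vertex k)) := hU.preimage (by fun_prop)
    refine h1.union_of_isOpen ?_ hU hU'
    have h2 : ContinuousOn (fun s => -f (-s)) (-sphTriangleInt (T.vertex k)) :=
      (h1.comp (g := f) (f := fun s : Sph => -s) (t := sphTriangleInt (T.vertex k))
        (by fun_prop) fun s hs => hs).neg
    exact h2.congr fun s _ => hodd s
  · refine hf.2.2 s fun k => ?_
    simpa using hs k
  · obtain ⟨C, hC⟩ := hbd k
    refine ⟨C, fun s hs => ?_⟩
    rcases hs with hs | hs
    · exact hC s hs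
    · rw [hodd, abs_neg]
      exact hC _ hs

theorem eq_zero_of_mem_oddSpace {f : Sph → ℝ} (hf : f ∈ T.oddSpace P) (h : f =ᵐ[dS] 0) :
    f = 0 := by
  have key : ∀ k, ∀ s ∈ sphTriangleInt (T.vertex k), f s = 0 := fun k s hs =>
    Measure.eqOn_open_of_ae_eq (ae_restrict_of_ae h) (isOpen_sphTriangleInt (T.nondegenerate k))
      (T.continuousOn_of_mem_oddSpace hP hf k) continuousOn_const hs
  ext s
  by_cases hs : ∀ k, s ∉ sphTriangleInt (T.vertex k) ∧ -s ∉ sphTriangleInt (T.vertex k)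
  · exact hf.2.2 s hs
  · push Not at hs
    obtain ⟨k, hk⟩ := hs
    by_cases h1 : s ∈ sphTriangleInt (T.vertex k)
    · exact key k s h1
    · have := key k _ (hk h1)
      rw [hf.1] at this
      simpa using this

end SphereMesh

namespace Discretization

variable {d : ℕ} {M : Medium d} (D : Discretization M)

theorem bddMeas_mu (k : Fin D.nSp) : BddMeas (D.mu k) := D.sphereMesh.bddMeas_mu k

theorem psi_mem (l : Fin D.nSm) : D.psi l ∈ D.sphereMesh.oddSpace D.localP := (D.ψ l).2

theorem bddMeas_psi (l : Fin D.nSm) : BddMeas (D.psi l) :=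
  D.sphereMesh.bddMeas_of_mem_oddSpace D.localP_continuousOn (D.psi_mem l)

theorem integrable_one_mul {F H : Sph → ℝ} (hF : BddMeas F) (hH : BddMeas H) :
    Integrable (fun s => 1 * F s * H s) dS :=
  integrable_mul_bddMeas_mul (integrable_const 1) hF hH

theorem gramSp_eq : D.gramSp = Matrix.of fun k k' => ∫ s, 1 * D.mu k s * D.mu k' s ∂dS := by
  simp [gramSp]

theorem gramSm_eq : D.gramSm = Matrix.of fun k k' => ∫ s, 1 * D.psi k s * D.psi k' s ∂dS := by
  simp [gramSm]

theorem gramSp_posDef : D.gramSp.PosDef := by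
  rw [gramSp_eq]
  exact gram_posDef (by simp) (fun i j => integrable_one_mul (D.bddMeas_mu i) (D.bddMeas_mu j))
    D.sphereMesh.eq_zero_of_sum_mul_mu

theorem gramSm_posDef : D.gramSm.PosDef := by
  rw [gramSm_eq]
  exact gram_posDef (by simp) (fun i j => integrable_one_mul (D.bddMeas_psi i) (D.bddMeas_psi j))
    fun x hx => eq_zero_of_sum_mul_basis_eq_zero D.ψ
      (D.sphereMesh.eq_zero_of_mem_oddSpace D.localP_continuousOn (sum_mul_basis_mem D.ψ x) hx)

/-- The Galerkin matrix of the scattering operator for a family of bounded functions. -/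
noncomputable def scatMatrix (M : Medium d) {n : ℕ} (F : Fin n → Sph → ℝ) :
    Matrix (Fin n) (Fin n) ℝ :=
  Matrix.of fun i j => ∫ s, M.scatter (F i) s * F j s ∂dS

section ScatMatrix

variable {n : ℕ} {F : Fin n → Sph → ℝ} (hF : ∀ i, BddMeas (F i))
include hF

theorem scatMatrix_apply (i j : Fin n) : scatMatrix M F i j = M.scatForm (F j) (F i) :=
  M.integral_scatter_mul (hF i) (hF j)

theorem scatMatrix_isSymm : (scatMatrix M F).IsSymm := by
  ext i j
  rw [transpose_apply, scatMatrix_apply hF, scatMatrix_apply hF, M.scatForm_comm]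

theorem dotProduct_scatMatrix_mulVec (x : Fin n → ℝ) :
    x ⬝ᵥ scatMatrix M F *ᵥ x =
      M.scatForm (fun s => ∑ i, x i * F i s) (fun s => ∑ i, x i * F i s) := by
  have hi : ∀ i j, Integrable (fun p => M.kernel p * (F i p.1 * F j p.2)) (dS.prod dS) :=
    fun i j => (M.bddMeas_kernel.mul (Medium.bddMeas_tensor (hF i) (hF j))).integrable
  have e : ∀ p : Sph × Sph, M.kernel p * ((∑ i, x i * F i p.1) * ∑ i, x i * F i p.2) =
      ∑ j, ∑ i, x i * x j * (M.kernel p * (F j p.1 * F i p.2)) := by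
    intro p
    rw [Finset.sum_mul_sum, Finset.mul_sum]
    refine Finset.sum_congr rfl fun j _ => ?_
    rw [Finset.mul_sum]
    exact Finset.sum_congr rfl fun i _ => by ring
  rw [Medium.scatForm]
  simp only [e]
  rw [integral_finsetSum _ fun j _ => integrable_finsetSum _ fun i _ => (hi j i).const_mul _,
    dotProduct]
  simp only [mulVec, dotProduct, Finset.mul_sum]
  rw [Finset.sum_comm]
  refine Finset.sum_congr rfl fun j _ => ?_
  rw [integral_finsetSum _ fun i _ => (hi j i).const_mul _]
  refine Finset.sum_congr rfl fun i _ => ?_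
  rw [integral_const_mul, scatMatrix_apply hF, Medium.scatForm]
  ring

theorem bddMeas_sum_mul (x : Fin n → ℝ) : BddMeas fun s => ∑ i, x i * F i s :=
  BddMeas.sum _ fun i _ => (BddMeas.const _).mul (hF i)

theorem scatMatrix_posSemidef : (scatMatrix M F).PosSemidef :=
  posSemidef_real_iff.2 ⟨scatMatrix_isSymm hF, fun x => by
    rw [dotProduct_scatMatrix_mulVec hF]
    exact M.scatForm_self_nonneg (bddMeas_sum_mul hF x)⟩

theorem smul_gram_sub_scatMatrix_posSemidef {t : ℝ}
    (ht : ∀ x : Fin n → ℝ, M.scatForm (fun s => ∑ i, x i * F i s) (fun s => ∑ i, x i * F i s) ≤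
      t * ∫ s, (∑ i, x i * F i s) ^ 2 ∂dS) :
    (t • (Matrix.of fun i j => ∫ s, 1 * F i s * F j s ∂dS) - scatMatrix M F).PosSemidef := by
  refine posSemidef_real_iff.2 ⟨?_, fun x => ?_⟩
  · rw [IsSymm, transpose_sub, transpose_smul, gram_isSymm, scatMatrix_isSymm hF]
  · rw [sub_mulVec, dotProduct_sub, smul_mulVec, dotProduct_smul,
      dotProduct_gram_mulVec (fun i j => integrable_one_mul (hF i) (hF j)),
      dotProduct_scatMatrix_mulVec hF, smul_eq_mul, sub_nonneg]
    simpa using ht x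

end ScatMatrix

theorem scatSp_posSemidef : D.scatSp.PosSemidef := scatMatrix_posSemidef D.bddMeas_mu

theorem scatSm_posSemidef : D.scatSm.PosSemidef := scatMatrix_posSemidef D.bddMeas_psi

theorem gramSp_sub_scatSp_posSemidef : (D.gramSp - D.scatSp).PosSemidef := by
  have := smul_gram_sub_scatMatrix_posSemidef (M := M) D.bddMeas_mu (t := 1) fun x => by
    rw [one_mul]
    exact M.scatForm_self_le (bddMeas_sum_mul D.bddMeas_mu x)
  rw [one_smul, ← gramSp_eq] at this
  exact this

theorem gramSm_sub_scatSm_posSemidef : (M.g • D.gramSm - D.scatSm).PosSemidef := by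
  have := smul_gram_sub_scatMatrix_posSemidef (M := M) D.bddMeas_psi (t := M.g) fun x =>
    M.scatForm_self_le_of_odd (bddMeas_sum_mul D.bddMeas_psi x)
      (sum_mul_basis_mem D.ψ x).1
  rw [← gramSm_eq] at this
  exact this

/-- Any point of the sphere must be covered by an element. Together with `nRp_pos` this makes the
space of unknowns nonzero. -/
theorem nSp_pos : 0 < D.nSp := by
  obtain ⟨k, -⟩ := D.sphereMesh.cover ⟨EuclideanSpace.single 0 1, by simp⟩
  exact k.pos

end Discretization

end RTE

/-! ### The coefficients -/

namespace RTE

open Set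

namespace Medium

variable {d : ℕ} (M : Medium d)

theorem isFiniteMeasure_R : IsFiniteMeasure (volume.restrict M.R) :=
  ⟨by simpa using M.bounded_R.measure_lt_top⟩

theorem integrable_σs : Integrable M.σs (volume.restrict M.R) :=
  have := M.isFiniteMeasure_R
  M.memLp_σs.integrable le_top

theorem integrable_σt : Integrable M.σt (volume.restrict M.R) :=
  have := M.isFiniteMeasure_R
  (M.memLp_σa.integrable le_top).add M.integrable_σs

theorem σt_pos : ∀ᵐ r ∂(volume.restrict M.R), 0 < M.σt r := by
  obtain ⟨γ, hγ, h⟩ := M.absorbing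
  filter_upwards [h, M.σs_nonneg] with r h1 h2
  rw [σt]
  linarith

/-- With `σs ≤ C` and `σa ≥ γ`, monotonicity of `t ↦ t / (γ + t)` gives the bound `C / (γ + C)`. It
yields both `c < 1` and the finiteness without which `toReal` in the definition of `c` would return
`0`. -/
theorem exists_ratio_bound : ∃ c₁ : ℝ, 0 ≤ c₁ ∧ c₁ < 1 ∧
    ∀ᵐ r ∂(volume.restrict M.R), ‖M.σs r / M.σt r‖ ≤ c₁ := by
  obtain ⟨γ, hγ, h⟩ := M.absorbing
  have hfin : eLpNormEssSup M.σs (volume.restrict M.R) ≠ ⊤ := by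
    rw [← eLpNorm_exponent_top]
    exact M.memLp_σs.2.ne
  set C := (eLpNormEssSup M.σs (volume.restrict M.R)).toReal
  have hC : 0 ≤ C := ENNReal.toReal_nonneg
  have hb : ∀ᵐ r ∂(volume.restrict M.R), ‖M.σs r‖ ≤ C := by
    filter_upwards [ae_le_eLpNormEssSup (f := M.σs)] with r hr
    rw [← toReal_enorm]
    exact ENNReal.toReal_mono hfin hr
  refine ⟨C / (γ + C), by positivity, (div_lt_one (by positivity)).2 (by linarith), ?_⟩
  filter_upwards [h, M.σs_nonneg, hb] with r h1 h2 h3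
  rw [Real.norm_eq_abs, abs_of_nonneg h2] at h3
  have hpos : 0 < M.σt r := by rw [σt]; linarith
  rw [Real.norm_eq_abs, abs_of_nonneg (by positivity), div_le_div_iff₀ hpos (by positivity), σt]
  nlinarith

theorem c_nonneg : 0 ≤ M.c := ENNReal.toReal_nonneg

theorem eLpNorm_ratio_le {c₁ : ℝ}
    (h : ∀ᵐ r ∂(volume.restrict M.R), ‖M.σs r / M.σt r‖ ≤ c₁) :
    eLpNorm (fun r => M.σs r / M.σt r) ⊤ (volume.restrict M.R) ≤ ENNReal.ofReal c₁ := by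
  rw [eLpNorm_exponent_top]
  exact eLpNormEssSup_le_of_ae_bound h

theorem c_lt_one : M.c < 1 := by
  obtain ⟨c₁, h0, h1, h⟩ := M.exists_ratio_bound
  refine lt_of_le_of_lt ?_ h1
  have := ENNReal.toReal_mono ENNReal.ofReal_ne_top (M.eLpNorm_ratio_le h)
  rwa [ENNReal.toReal_ofReal h0] at this

theorem σs_le : ∀ᵐ r ∂(volume.restrict M.R), M.σs r ≤ M.c * M.σt r := by
  obtain ⟨c₁, -, -, h⟩ := M.exists_ratio_bound
  have hfin : eLpNorm (fun r => M.σs r / M.σt r) ⊤ (volume.restrict M.R) ≠ ⊤ :=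
    ((M.eLpNorm_ratio_le h).trans_lt ENNReal.ofReal_lt_top).ne
  rw [eLpNorm_exponent_top] at hfin
  filter_upwards [ae_le_eLpNormEssSup (f := fun r => M.σs r / M.σt r)
    (μ := volume.restrict M.R), M.σt_pos] with r hr hpos
  have h2 := ENNReal.toReal_mono hfin hr
  rw [toReal_enorm, ← eLpNorm_exponent_top] at h2
  have h3 : M.σs r / M.σt r ≤ M.c := (le_abs_self _).trans h2
  rwa [div_le_iff₀ hpos] at h3

theorem isCompact_closure_R : IsCompact (closure M.R) := M.bounded_R.isCompact_closure

/-- Convexity excludes slits. Hence interiors of mesh elements, known only to lie in the closure,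
lie in `R` itself. -/
theorem interior_closure_R : interior (closure M.R) = M.R := by
  rw [M.convex_R.interior_closure_eq_interior_of_nonempty_interior, M.isOpen_R.interior_eq]
  rw [M.isOpen_R.interior_eq]
  exact M.nonempty_R

end Medium

/-! ### The spatial matrices -/

namespace DomainMesh

variable {d : ℕ} {M : Medium d} (T : DomainMesh M.R)

theorem bddMeas_of_mem_P1c {f : Pos d → ℝ} (hf : f ∈ T.P1c) : BddMeas f := by
  obtain ⟨C, hC⟩ := M.isCompact_closure_R.exists_bound_of_continuousOn hf.1
  exact BddMeas.of_continuousOn isClosed_closure.measurableSet hf.1 hf.2.2 hC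

theorem eq_zero_of_mem_P1c {f : Pos d → ℝ} (hf : f ∈ T.P1c)
    (h : f =ᵐ[volume.restrict M.R] 0) : f = 0 := by
  have h1 : EqOn f 0 M.R :=
    Measure.eqOn_open_of_ae_eq h M.isOpen_R (hf.1.mono subset_closure) continuousOn_const
  have h2 : EqOn f 0 (closure M.R) :=
    h1.of_subset_closure hf.1 continuousOn_const subset_closure subset_rfl
  ext r
  by_cases hr : r ∈ closure M.R
  · exact h2 hr
  · exact hf.2.2 r hr

theorem interior_element_subset {t : Finset (Pos d)} (ht : t ∈ T.elements) :
    interior (convexHull ℝ (t : Set (Pos d))) ⊆ M.R := by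
  rw [← M.interior_closure_R, ← T.space_eq]
  exact interior_mono (Geometry.SimplicialComplex.convexHull_subset_space ht.1)

theorem bddMeas_of_mem_P0 {f : Pos d → ℝ} (hf : f ∈ T.P0) : BddMeas f := by
  have : Finite T.elements := T.finite_faces.subset fun t ht => ht.1
  refine BddMeas.of_iUnion
    (U := fun t : T.elements => interior (convexHull ℝ (t.1 : Set (Pos d))))
    (fun t => isOpen_interior) (fun t => ?_) (fun r hr => hf.2 r fun t ht => hr ⟨t, ht⟩)
    fun t => ?_
  · obtain ⟨a, ha⟩ := hf.1 t.1 t.2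
    exact continuousOn_const.congr ha
  · obtain ⟨a, ha⟩ := hf.1 t.1 t.2
    exact ⟨|a|, fun r hr => by rw [ha r hr]⟩

theorem eq_zero_of_mem_P0 {f : Pos d → ℝ} (hf : f ∈ T.P0)
    (h : f =ᵐ[volume.restrict M.R] 0) : f = 0 := by
  ext r
  by_cases hr : ∀ t ∈ T.elements, r ∉ interior (convexHull ℝ (t : Set (Pos d)))
  · exact hf.2 r hr
  · push Not at hr
    obtain ⟨t, ht, hrt⟩ := hr
    obtain ⟨a, ha⟩ := hf.1 t ht
    exact Measure.eqOn_open_of_ae_eq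
      (ae_restrict_of_ae_restrict_of_subset (T.interior_element_subset ht) h) isOpen_interior
      (continuousOn_const.congr ha) continuousOn_const hrt

theorem indicator_closure_mem_P1c : (closure M.R).indicator (fun _ => (1 : ℝ)) ∈ T.P1c := by
  refine ⟨continuousOn_const.congr fun r hr => indicator_of_mem hr _, fun t ht => ?_,
    fun r hr => indicator_of_notMem hr _⟩
  refine ⟨AffineMap.const ℝ _ 1, fun r hr => ?_⟩
  have := Geometry.SimplicialComplex.convexHull_subset_space ht.1 hr
  rw [T.space_eq] at this
  rw [indicator_of_mem this]
  rfl

end DomainMesh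

namespace Discretization

variable {d : ℕ} {M : Medium d} (D : Discretization M)

theorem bddMeas_phi (i : Fin D.nRp) : BddMeas (D.phi i) :=
  D.domainMesh.bddMeas_of_mem_P1c (D.φ i).2

theorem bddMeas_chi (j : Fin D.nRm) : BddMeas (D.chi j) :=
  D.domainMesh.bddMeas_of_mem_P0 (D.χ j).2

theorem massRp_posDef : (D.massRp M.σt).PosDef :=
  gram_posDef M.σt_pos (fun i j =>
    integrable_mul_bddMeas_mul M.integrable_σt (D.bddMeas_phi i) (D.bddMeas_phi j))
    fun x hx => eq_zero_of_sum_mul_basis_eq_zero D.φ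
      (D.domainMesh.eq_zero_of_mem_P1c (sum_mul_basis_mem D.φ x) hx)

theorem massRm_posDef : (D.massRm M.σt).PosDef :=
  gram_posDef M.σt_pos (fun i j =>
    integrable_mul_bddMeas_mul M.integrable_σt (D.bddMeas_chi i) (D.bddMeas_chi j))
    fun x hx => eq_zero_of_sum_mul_basis_eq_zero D.χ
      (D.domainMesh.eq_zero_of_mem_P0 (sum_mul_basis_mem D.χ x) hx)

theorem massRp_σs_posSemidef : (D.massRp M.σs).PosSemidef :=
  gram_posSemidef M.σs_nonneg fun i j =>
    integrable_mul_bddMeas_mul M.integrable_σs (D.bddMeas_phi i) (D.bddMeas_phi j)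

theorem massRm_σs_posSemidef : (D.massRm M.σs).PosSemidef :=
  gram_posSemidef M.σs_nonneg fun i j =>
    integrable_mul_bddMeas_mul M.integrable_σs (D.bddMeas_chi i) (D.bddMeas_chi j)

/-- The difference is again a Gram matrix, with weight `c σt - σs ≥ 0`. -/
theorem smul_gram_sub_gram_posSemidef {n : ℕ} {F : Fin n → Pos d → ℝ} (hF : ∀ i, BddMeas (F i)) :
    (M.c • (Matrix.of fun i j => ∫ r in M.R, M.σt r * F i r * F j r) -
      Matrix.of fun i j => ∫ r in M.R, M.σs r * F i r * F j r).PosSemidef := by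
  have ht : ∀ i j, Integrable (fun r => M.σt r * F i r * F j r) (volume.restrict M.R) :=
    fun i j => integrable_mul_bddMeas_mul M.integrable_σt (hF i) (hF j)
  have hs : ∀ i j, Integrable (fun r => M.σs r * F i r * F j r) (volume.restrict M.R) :=
    fun i j => integrable_mul_bddMeas_mul M.integrable_σs (hF i) (hF j)
  have e : M.c • (Matrix.of fun i j => ∫ r in M.R, M.σt r * F i r * F j r) -
      (Matrix.of fun i j => ∫ r in M.R, M.σs r * F i r * F j r) =
      Matrix.of fun i j => ∫ r in M.R, (M.c * M.σt r - M.σs r) * F i r * F j r := by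
    ext i j
    simp only [Matrix.sub_apply, Matrix.smul_apply, Matrix.of_apply, smul_eq_mul]
    rw [← integral_const_mul, ← integral_sub ((ht i j).const_mul _) (hs i j)]
    congr 1
    ext r
    ring
  rw [e]
  refine gram_posSemidef (M.σs_le.mono fun r hr => sub_nonneg.2 hr) fun i j =>
    integrable_mul_bddMeas_mul ((M.integrable_σt.const_mul _).sub M.integrable_σs) (hF i) (hF j)

theorem smul_massRp_sub_posSemidef : (M.c • D.massRp M.σt - D.massRp M.σs).PosSemidef :=
  smul_gram_sub_gram_posSemidef D.bddMeas_phi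

theorem smul_massRm_sub_posSemidef : (M.c • D.massRm M.σt - D.massRm M.σs).PosSemidef :=
  smul_gram_sub_gram_posSemidef D.bddMeas_chi

/-- The constant one on the closure of `R` is a nonzero element of the finite element space. -/
theorem nRp_pos : 0 < D.nRp := by
  rw [Nat.pos_iff_ne_zero]
  intro h0
  have : IsEmpty (Fin D.nRp) := by rw [h0]; infer_instance
  set f : D.domainMesh.P1c := ⟨_, D.domainMesh.indicator_closure_mem_P1c⟩ with hf
  have h1 : f = 0 := by
    rw [← D.φ.sum_repr f]
    simp
  obtain ⟨r, hr⟩ := M.nonempty_R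
  have h2 := congrFun (congrArg Subtype.val h1) r
  simp [hf, subset_closure hr] at h2

end Discretization

/-! ### The surface measure of the boundary -/

section Boundary

open Measure

/-- Fixing one vertex `p`, the hull lies in the image of a unit cube, with one dimension for each
remaining vertex, under a Lipschitz affine map. -/
theorem hausdorffMeasure_convexHull_lt_top {E : Type*} [NormedAddCommGroup E] [NormedSpace ℝ E]
    [MeasurableSpace E] [BorelSpace E] (s : Finset E) {k : ℕ} (hs : s.card ≤ k + 1) :
    μH[k] (convexHull ℝ (s : Set E)) < ⊤ := by
  classical
  rcases s.eq_empty_or_nonempty with rfl | ⟨p, hp⟩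
  · simp
  set ι := {x // x ∈ s.erase p}
  set A : (ι → ℝ) →L[ℝ] E :=
    ∑ i : ι, (ContinuousLinearMap.proj (R := ℝ) (φ := fun _ : ι => ℝ) i).smulRight (i.1 - p)
  have hA : ∀ t : ι → ℝ, A t = ∑ i : ι, t i • (i.1 - p) := fun t => by
    simp [A]
  have hlip : LipschitzWith ‖A‖₊ fun t => p + A t := by
    simpa using (LipschitzWith.const p).add A.lipschitz
  have hsub : convexHull ℝ (s : Set E) ⊆ (fun t => p + A t) '' Icc 0 1 := by
    intro x hx
    obtain ⟨w, hw0, hw1, rfl⟩ := Finset.mem_convexHull.1 hx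
    refine ⟨fun i => w i, ⟨fun i => hw0 _ (Finset.mem_of_mem_erase i.2), fun i => ?_⟩, ?_⟩
    · rw [Pi.one_apply, ← hw1]
      exact Finset.single_le_sum hw0 (Finset.mem_of_mem_erase i.2)
    · rw [Finset.centerMass_eq_of_sum_1 _ _ hw1]
      simp only [hA, id]
      rw [Finset.sum_coe_sort (s.erase p) fun y => w y • (y - p),
        ← Finset.add_sum_erase s _ hp]
      rw [← Finset.add_sum_erase s _ hp] at hw1
      simp only [smul_sub, Finset.sum_sub_distrib, ← Finset.sum_smul]
      rw [← eq_sub_iff_add_eq'] at hw1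
      rw [hw1, sub_smul, one_smul]
      abel
  have hcard : (Fintype.card ι : ℝ) ≤ k := by
    rw [Fintype.card_coe, Finset.card_erase_of_mem hp]
    exact_mod_cast (by omega)
  calc μH[k] (convexHull ℝ (s : Set E)) ≤ μH[Fintype.card ι] (convexHull ℝ (s : Set E)) :=
        hausdorffMeasure_mono hcard _
    _ ≤ μH[Fintype.card ι] ((fun t => p + A t) '' Icc 0 1) := measure_mono hsub
    _ ≤ (‖A‖₊ : ENNReal) ^ (Fintype.card ι : ℝ) * μH[Fintype.card ι] (Icc (0 : ι → ℝ) 1) :=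
        hlip.lipschitzOnWith.hausdorffMeasure_image_le (Nat.cast_nonneg _)
    _ < ⊤ := by
        rw [hausdorffMeasure_pi_real]
        exact ENNReal.mul_lt_top (ENNReal.rpow_lt_top_of_nonneg (Nat.cast_nonneg _)
          ENNReal.coe_ne_top) isCompact_Icc.measure_lt_top

/-- A point of a simplex lies in its interior or in one of its facets. -/
theorem mem_interior_or_mem_facet {d : ℕ} {t : Finset (Pos d)}
    (ht : AffineIndependent ℝ ((↑) : t → Pos d)) (hcard : t.card = d + 1) {x : Pos d}
    (hx : x ∈ convexHull ℝ (t : Set (Pos d))) :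
    x ∈ interior (convexHull ℝ (t : Set (Pos d))) ∨
      ∃ y ∈ t, x ∈ convexHull ℝ ((t.erase y : Finset (Pos d)) : Set (Pos d)) := by
  obtain ⟨w, hw0, hw1, hwx⟩ := Finset.mem_convexHull.1 hx
  rw [Finset.centerMass_eq_of_sum_1 _ _ hw1] at hwx
  by_cases h : ∃ y ∈ t, w y = 0
  · obtain ⟨y, hy, hwy⟩ := h
    right
    refine ⟨y, hy, Finset.mem_convexHull.2 ⟨w, fun z hz => hw0 z (Finset.mem_of_mem_erase hz), ?_⟩⟩
    have h1 : ∑ z ∈ t.erase y, w z = 1 := by rw [← hw1, ← Finset.add_sum_erase t w hy, hwy, zero_add]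
    refine ⟨h1, ?_⟩
    rw [Finset.centerMass_eq_of_sum_1 _ _ h1, ← hwx, ← Finset.add_sum_erase t _ hy, hwy, zero_smul,
      zero_add]
  · push Not at h
    left
    have htop : affineSpan ℝ (range ((↑) : t → Pos d)) = ⊤ := by
      rw [ht.affineSpan_eq_top_iff_card_eq_finrank_add_one]
      simp [hcard]
    set b : AffineBasis t ℝ (Pos d) := ⟨(↑), ht, htop⟩
    have hbr : range b = (t : Set (Pos d)) := Subtype.range_coe
    have hw1' : ∑ i : t, w i = 1 := by rw [Finset.sum_coe_sort t w, hw1]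
    have hx' : x = Finset.univ.affineCombination ℝ b fun i : t => w i := by
      rw [Finset.affineCombination_eq_linear_combination _ _ _ hw1', ← hwx]
      exact (Finset.sum_coe_sort t fun y => w y • y).symm
    rw [← hbr, b.interior_convexHull]
    intro i
    rw [hx', b.coord_apply_combination_of_mem (Finset.mem_univ i) hw1']
    exact (hw0 i i.2).lt_of_ne (h i i.2).symm

/-- Finitely many faces with at most `d` vertices cover the boundary: a boundary point lies in a
lower-dimensional face or in a full simplex, and then in one of its facets since the interior
belongs to `R`. Finiteness makes the boundary integrals genuine. -/
theorem DomainMesh.euclideanHausdorffMeasure_frontier_lt_top {d : ℕ} {M : Medium d}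
    (T : DomainMesh M.R) : (μHE[d - 1] : Measure (Pos d)) (frontier M.R) < ⊤ := by
  have hd := M.dim_pos
  set F : Set (Finset (Pos d)) := {s | s.card ≤ d ∧ ∃ t ∈ T.complex.faces, s ⊆ t} with hF
  have hFfin : F.Finite := by
    refine (T.finite_faces.biUnion fun t _ => t.powerset.finite_toSet).subset ?_
    rintro s ⟨-, t, ht, hst⟩
    exact mem_iUnion₂.2 ⟨t, ht, by simpa using hst⟩
  have hsub : frontier M.R ⊆ ⋃ s ∈ F, convexHull ℝ (s : Set (Pos d)) := by
    intro x hx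
    rw [M.isOpen_R.frontier_eq] at hx
    have hxs := hx.1
    rw [← T.space_eq] at hxs
    obtain ⟨t, ht, hxt⟩ := Geometry.SimplicialComplex.mem_space_iff.1 hxs
    have hind := T.complex.indep ht
    have hle : t.card ≤ d + 1 := by
      have := hind.card_le_finrank_succ
      simp only [Fintype.card_coe] at this
      refine this.trans (Nat.succ_le_succ ((Submodule.finrank_le _).trans ?_))
      simp
    rcases hle.lt_or_eq with hlt | heq
    · exact mem_iUnion₂.2 ⟨t, ⟨Nat.lt_succ_iff.1 hlt, t, ht, subset_rfl⟩, hxt⟩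
    · rcases mem_interior_or_mem_facet hind heq hxt with h | ⟨y, hy, h⟩
      · exact absurd (T.interior_element_subset ⟨ht, heq⟩ h) hx.2
      · refine mem_iUnion₂.2 ⟨t.erase y, ⟨?_, t, ht, t.erase_subset y⟩, h⟩
        rw [Finset.card_erase_of_mem hy, heq]
        simp
  have hH : (μH[(d - 1 : ℕ)] : Measure (Pos d)) (frontier M.R) < ⊤ := by
    refine (measure_mono hsub).trans_lt (measure_biUnion_lt_top hFfin fun s hs => ?_)
    exact hausdorffMeasure_convexHull_lt_top s (by have := hs.1; omega)
  rw [euclideanHausdorffMeasure_def, Measure.smul_apply]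
  exact ENNReal.mul_lt_top ENNReal.coe_lt_top hH

theorem Medium.continuous_dir {d : ℕ} (M : Medium d) : Continuous M.dir := by
  unfold Medium.dir
  fun_prop

namespace Discretization

variable {d : ℕ} {M : Medium d} (D : Discretization M)

/-- Bounded almost everywhere on a set of finite surface measure, since the normal has length one
almost everywhere; measurability comes from integrating a jointly measurable function over `S`. -/
theorem integrable_omega (k : Fin D.nSp) :
    Integrable (D.omega k) ((μHE[d - 1] : Measure (Pos d)).restrict (frontier M.R)) := by
  have hfin : IsFiniteMeasure ((μHE[d - 1] : Measure (Pos d)).restrict (frontier M.R)) :=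
    ⟨by simpa using D.domainMesh.euclideanHausdorffMeasure_frontier_lt_top⟩
  have hm : Measurable (D.omega k) := by
    have h1 : Measurable fun p : Pos d × Sph =>
        |inner ℝ (M.dir p.2) (M.n p.1)| * D.mu k p.2 ^ 2 := by
      refine Measurable.mul ?_ (((D.bddMeas_mu k).1.comp measurable_snd).pow_const 2)
      exact continuous_abs.measurable.comp ((M.continuous_dir.measurable.comp measurable_snd).inner
        (M.measurable_n.comp measurable_fst))
    exact h1.stronglyMeasurable.integral_prod_right'.measurable
  obtain ⟨C, hC⟩ := isCompact_univ.exists_bound_of_continuousOn M.continuous_dir.continuousOn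
  obtain ⟨B, hB⟩ := ((D.bddMeas_mu k).pow 2).2
  refine Integrable.of_bound hm.aestronglyMeasurable (C * B * dS.real univ) ?_
  filter_upwards [M.n_normal] with r hr
  refine norm_integral_le_of_norm_le_const (Eventually.of_forall fun s => ?_)
  rw [norm_mul, Real.norm_eq_abs |_|, abs_abs]
  have h1 := norm_inner_le_norm (𝕜 := ℝ) (M.dir s) (M.n r)
  rw [hr.1, mul_one] at h1
  have h2 := hC s (mem_univ s)
  exact mul_le_mul (h1.trans h2) (hB s) (norm_nonneg _) ((norm_nonneg _).trans h2)

theorem bdryR_posSemidef (k : Fin D.nSp) : (D.bdryR k).PosSemidef := by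
  have e : D.bdryR k = Matrix.of fun i i' => ∫ r in frontier M.R,
      D.omega k r * D.phi i r * D.phi i' r ∂(μHE[d - 1] : Measure (Pos d)) := by
    ext i i'
    simp only [bdryR, Matrix.of_apply]
    congr 1
    ext r
    ring
  rw [e]
  refine gram_posSemidef (Eventually.of_forall fun r => ?_) fun i j =>
    integrable_mul_bddMeas_mul (D.integrable_omega k) (D.bddMeas_phi i) (D.bddMeas_phi j)
  exact integral_nonneg fun s => mul_nonneg (abs_nonneg _) (sq_nonneg _)

/-- A block-diagonal matrix is a sum of Kronecker products of coordinate projections with its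
blocks. -/
theorem Rmat_posSemidef : D.Rmat.PosSemidef := by
  have e : D.Rmat = ∑ k, Matrix.diagonal (Pi.single k (1 : ℝ)) ⊗ₖ D.bdryR k := by
    ext ⟨k, i⟩ ⟨k', i'⟩
    simp only [Rmat, Matrix.of_apply, Matrix.sum_apply, Matrix.kroneckerMap_apply,
      Matrix.diagonal_apply]
    by_cases h : k = k'
    · subst h
      rw [Finset.sum_eq_single k]
      · simp
      · intro j _ hj
        simp [hj.symm]
      · simp
    · simp [h]
  rw [e]
  refine Matrix.posSemidef_sum _ fun k _ => Matrix.PosSemidef.kronecker ?_ (D.bdryR_posSemidef k)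
  exact Matrix.PosSemidef.diagonal (Pi.single_nonneg.2 zero_le_one)

end Discretization

end Boundary

end RTE

/-! ### The block matrices -/

namespace RTE

theorem _root_.Matrix.PosDef.inv_smul {ι : Type*} [Fintype ι] [DecidableEq ι] {B : Matrix ι ι ℝ}
    (hB : B.PosDef) {t : ℝ} (ht : t ≠ 0) : (t • B)⁻¹ = t⁻¹ • B⁻¹ := by
  refine Matrix.inv_eq_right_inv ?_
  rw [Matrix.smul_mul, Matrix.mul_smul, smul_smul, mul_inv_cancel₀ ht, one_smul,
    Matrix.mul_nonsing_inv _ hB.isUnit_det]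

namespace Discretization

variable {d : ℕ} {M : Medium d} (D : Discretization M)

theorem c_mul_g_lt_one (M : Medium d) : M.c * M.g < 1 := by
  have h1 := M.c_nonneg
  have h2 := M.c_lt_one
  have h3 := M.g_nonneg
  have h4 := M.g_lt_one
  nlinarith

/-- Insert the mixed term `S ⊗ bT`: the difference is `(aG - S) ⊗ bT + S ⊗ (bT - U)`. Used with `b =
c` and `a = 1` (even part) or `a = g` (odd part). -/
theorem kronecker_sub_kronecker_posSemidef {m n : ℕ} {G S : Matrix (Fin m) (Fin m) ℝ}
    {T U : Matrix (Fin n) (Fin n) ℝ} {a b : ℝ} (hb : 0 ≤ b) (hGS : (a • G - S).PosSemidef)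
    (hS : S.PosSemidef) (hT : T.PosSemidef) (hTU : (b • T - U).PosSemidef) :
    ((b * a) • G ⊗ₖ T - S ⊗ₖ U).PosSemidef := by
  have e : (b * a) • G ⊗ₖ T - S ⊗ₖ U = (a • G - S) ⊗ₖ (b • T) + S ⊗ₖ (b • T - U) := by
    ext ⟨i, j⟩ ⟨i', j'⟩
    simp only [Matrix.sub_apply, Matrix.add_apply, Matrix.smul_apply, Matrix.kroneckerMap_apply,
      smul_eq_mul]
    ring
  rw [e]
  exact (hGS.kronecker (hT.smul hb)).add (hS.kronecker hTU)

theorem Mp_posDef : D.Mp.PosDef := D.gramSp_posDef.kronecker D.massRp_posDef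

theorem Mm_posDef : D.Mm.PosDef := D.gramSm_posDef.kronecker D.massRm_posDef

theorem Kp_posSemidef : D.Kp.PosSemidef := D.scatSp_posSemidef.kronecker D.massRp_σs_posSemidef

theorem Km_posSemidef : D.Km.PosSemidef := D.scatSm_posSemidef.kronecker D.massRm_σs_posSemidef

theorem smul_Mp_sub_Kp_posSemidef : (M.c • D.Mp - D.Kp).PosSemidef := by
  have := kronecker_sub_kronecker_posSemidef (a := 1) M.c_nonneg
    (by simpa using D.gramSp_sub_scatSp_posSemidef) D.scatSp_posSemidef
    D.massRp_posDef.posSemidef D.smul_massRp_sub_posSemidef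
  rwa [mul_one] at this

theorem smul_Mm_sub_Km_posSemidef : ((M.c * M.g) • D.Mm - D.Km).PosSemidef :=
  kronecker_sub_kronecker_posSemidef M.c_nonneg D.gramSm_sub_scatSm_posSemidef
    D.scatSm_posSemidef D.massRm_posDef.posSemidef D.smul_massRm_sub_posSemidef

theorem smul_Mm_posDef : ((1 - M.c * M.g) • D.Mm).PosDef :=
  D.Mm_posDef.smul (sub_pos.2 (c_mul_g_lt_one M))

theorem Mm_sub_Km_sub_posSemidef :
    (D.Mm - D.Km - (1 - M.c * M.g) • D.Mm).PosSemidef := by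
  convert D.smul_Mm_sub_Km_posSemidef using 1
  rw [sub_smul, one_smul]
  abel

theorem Mm_sub_Km_posDef : (D.Mm - D.Km).PosDef :=
  D.smul_Mm_posDef.of_sub_posSemidef D.Mm_sub_Km_sub_posSemidef

theorem inv_Mm_sub_Km_le :
    ((1 / (1 - M.c * M.g)) • D.Mm⁻¹ - (D.Mm - D.Km)⁻¹).PosSemidef := by
  have := D.smul_Mm_posDef.inv_sub_inv_posSemidef D.Mm_sub_Km_sub_posSemidef
  rwa [D.Mm_posDef.inv_smul (sub_pos.2 (c_mul_g_lt_one M)).ne', ← one_div] at this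

theorem inv_Mm_le : ((D.Mm - D.Km)⁻¹ - D.Mm⁻¹).PosSemidef :=
  D.Mm_sub_Km_posDef.inv_sub_inv_posSemidef (by simpa using D.Km_posSemidef)

theorem E_posDef : D.E.PosDef :=
  (Matrix.PosDef.posSemidef_add
    (D.Mm_sub_Km_posDef.inv.posSemidef.transpose_mul_mul_same D.A) D.Mp_posDef).add_posSemidef
    D.Rmat_posSemidef

theorem E0_sub_E_posSemidef : (D.E0 - D.E).PosSemidef := by
  convert D.inv_Mm_sub_Km_le.transpose_mul_mul_same D.A using 1
  rw [E0, E, Matrix.mul_sub, Matrix.sub_mul, Matrix.mul_smul, Matrix.smul_mul]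
  abel

theorem E0_posDef : D.E0.PosDef := D.E_posDef.of_sub_posSemidef D.E0_sub_E_posSemidef

/-- With `r = (1 - c)/(1 - cg) ≤ 1`, the matrix is the sum of four semidefinite ones: `Aᵀ((M⁻ -
K⁻)⁻¹ - (M⁻)⁻¹)A`, `(1 - r) Aᵀ(M⁻)⁻¹A`, `c R` and `c M⁺ - K⁺`. -/
theorem E_sub_Kp_sub_posSemidef : (D.E - D.Kp - (1 - M.c) • D.E0).PosSemidef := by
  have hcg := sub_pos.2 (c_mul_g_lt_one M)
  have hc := M.c_nonneg
  have hg := M.g_lt_one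
  set r := (1 - M.c) * (1 / (1 - M.c * M.g)) with hr
  have hr1 : 0 ≤ 1 - r := by
    rw [hr, mul_one_div, sub_nonneg, div_le_one hcg]
    nlinarith
  have h1 := D.inv_Mm_le.transpose_mul_mul_same D.A
  have h2 := (D.Mm_posDef.inv.posSemidef.transpose_mul_mul_same D.A).smul hr1
  have h3 := D.Rmat_posSemidef.smul hc
  convert ((h1.add h2).add h3).add D.smul_Mp_sub_Kp_posSemidef using 1
  rw [E0, E, Matrix.mul_sub, Matrix.sub_mul, smul_add, smul_add, smul_smul, ← hr]
  simp only [sub_smul, one_smul]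
  abel

theorem E_sub_Kp_posDef : (D.E - D.Kp).PosDef :=
  (D.E0_posDef.smul (sub_pos.2 M.c_lt_one)).of_sub_posSemidef D.E_sub_Kp_sub_posSemidef

/-- Passes through `E⁻¹`: the inner iterates stay below it, and `K⁺ ≥ 0` puts it below `(E - K⁺)⁻¹`.
-/
theorem inv_sub_innerPrecond_posSemidef (l : ℕ) :
    ((D.E - D.Kp)⁻¹ - innerPrecond D.E D.E0 l).PosSemidef := by
  have h1 := D.E_sub_Kp_posDef.inv_sub_inv_posSemidef (B := D.E) (by simpa using D.Kp_posSemidef)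
  have h2 := RTE.inv_sub_innerPrecond_posSemidef D.E_posDef D.E0_sub_E_posSemidef l
  simpa using h1.add h2

/-- Passes through `E₀⁻¹`: inverting `(1 - c) E₀ ≤ E - K⁺` gives `(1 - c)(E - K⁺)⁻¹ ≤ E₀⁻¹`, and
from the first inner step on the iterates lie above `E₀⁻¹`. -/
theorem innerPrecond_sub_smul_inv_posSemidef {l : ℕ} (hl : 1 ≤ l) :
    (innerPrecond D.E D.E0 l - (1 - M.c) • (D.E - D.Kp)⁻¹).PosSemidef := by
  have hc := sub_pos.2 M.c_lt_one
  have h1 := (D.E0_posDef.smul hc).inv_sub_inv_posSemidef D.E_sub_Kp_sub_posSemidef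
  rw [D.E0_posDef.inv_smul hc.ne'] at h1
  have h2 := h1.smul hc.le
  rw [smul_sub, smul_smul, mul_inv_cancel₀ hc.ne', one_smul] at h2
  simpa using (RTE.innerPrecond_sub_inv_posSemidef D.E_posDef D.E0_sub_E_posSemidef hl).add h2

end Discretization

end RTE

/-! ### Assembly of the convergence result -/

theorem lemma5p3 {d : ℕ} (M : RTE.Medium d) (D : RTE.Discretization M)
    {m : ℕ} (W : Matrix D.IdxP (Fin m) ℝ) (hW : LinearIndependent ℝ W.col)
    (l : ℕ) (hl : 1 ≤ l) :
    -- the matrices that are inverted are positive definite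
    D.Mm.PosDef ∧ (D.Mm - D.Km).PosDef ∧ D.E.PosDef ∧ D.E0.PosDef ∧ (D.E - D.Kp).PosDef ∧
    (Wᵀ * (D.E - D.Kp) * W).PosDef ∧
    -- the inexact preconditioner is positive definite and lies between `E₀⁻¹` and `E⁻¹`
    (RTE.innerPrecond D.E D.E0 l).PosDef ∧
    (∀ x : D.IdxP → ℝ,
      x ⬝ᵥ D.E0⁻¹ *ᵥ x ≤ x ⬝ᵥ RTE.innerPrecond D.E D.E0 l *ᵥ x ∧
      x ⬝ᵥ RTE.innerPrecond D.E D.E0 l *ᵥ x ≤ x ⬝ᵥ D.E⁻¹ *ᵥ x) ∧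
    -- the outer iteration converges with contraction factor `η ≤ c < 1`
    ∃ η : ℝ,
      IsLUB (RTE.contractionValues (D.E - D.Kp) (RTE.innerPrecond D.E D.E0 l) W) η ∧
      0 ≤ η ∧ η ≤ M.c ∧ M.c < 1 ∧
      ∀ q : D.IdxP → ℝ,
        (∃! u : D.IdxP → ℝ, D.E *ᵥ u = D.Kp *ᵥ u + q) ∧
        ∀ u u₀ : D.IdxP → ℝ, D.E *ᵥ u = D.Kp *ᵥ u + q →
          (∀ n : ℕ,
            RTE.energyNorm (D.E - D.Kp) (u - RTE.outerIterate (D.E - D.Kp)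
              (RTE.innerPrecond D.E D.E0 l) W q u₀ (n + 1)) ≤
            η * RTE.energyNorm (D.E - D.Kp) (u - RTE.outerIterate (D.E - D.Kp)
              (RTE.innerPrecond D.E D.E0 l) W q u₀ n)) ∧
          Tendsto (RTE.outerIterate (D.E - D.Kp)
            (RTE.innerPrecond D.E D.E0 l) W q u₀) atTop (𝓝 u) := by
  have hQ := D.E_sub_Kp_posDef
  have hE := D.E_posDef
  have hEE := D.E0_sub_E_posSemidef
  have hWQW := hQ.transpose_mul_mul_of_linearIndependent hW
  have : Nonempty D.IdxP := ⟨(⟨0, D.nSp_pos⟩, ⟨0, D.nRp_pos⟩)⟩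
  -- The constant `c` comes entirely from the preconditioned step; the Galerkin correction only has
  -- norm at most one.
  obtain ⟨η, hlub, h0, hηc, hconv⟩ := RTE.exists_contraction_factor hQ
    (P := RTE.innerPrecond D.E D.E0 l) (W := W) M.c_lt_one fun v => by
      rw [← mulVec_mulVec]
      exact (RTE.energyNorm_one_sub_galerkinProj_le hQ hWQW _).trans
        (RTE.energyNorm_one_sub_mul_le hQ M.c_nonneg (D.inv_sub_innerPrecond_posSemidef l)
          (D.innerPrecond_sub_smul_inv_posSemidef hl) v)
  have hiff : ∀ u q : D.IdxP → ℝ, D.E *ᵥ u = D.Kp *ᵥ u + q ↔ (D.E - D.Kp) *ᵥ u = q := by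
    intro u q
    rw [sub_mulVec, sub_eq_iff_eq_add']
  refine ⟨D.Mm_posDef, D.Mm_sub_Km_posDef, hE, D.E0_posDef, hQ, hWQW,
    RTE.innerPrecond_posDef hE hEE hl, fun x => ⟨?_, ?_⟩, η, hlub, h0, hηc, M.c_lt_one,
    fun q => ⟨⟨(D.E - D.Kp)⁻¹ *ᵥ q, ?_, fun u hu => ?_⟩, fun u u₀ hu => ?_⟩⟩
  · exact form_le_of_sub_posSemidef (RTE.innerPrecond_sub_inv_posSemidef hE hEE hl) x
  · exact form_le_of_sub_posSemidef (RTE.inv_sub_innerPrecond_posSemidef hE hEE l) x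
  · simp only [hiff]
    rw [mulVec_mulVec, mul_nonsing_inv _ hQ.isUnit_det, one_mulVec]
  · rw [← (hiff u q).1 hu, mulVec_mulVec, nonsing_inv_mul _ hQ.isUnit_det, one_mulVec]
  · exact hconv q u u₀ ((hiff u q).1 hu)
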